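/- **Setting.** Let $G=\mathcal P_{\mathrm{aff}}=\mathbb R^2\rtimes(\mathbb R_+\times \mathrm{SO}(1,1))$ be the affine Poincaré group, i.e. the set of triples $(b,a,\vartheta)$ with $b\in\mathbb R^2$, $a>0$, $\vartheta\in\mathbb R$ and the product $(b,a,\vartheta)(b',a',\vartheta')=(b+a\Lambda_\vartheta b',\,aa',\,\vartheta+\vartheta')$, where $\Lambda_\vartheta=\begin{pmatrix}\cosh\vartheta&\sinh\vartheta\\ \sinh\vartheta&\cosh\vartheta\end{pmatrix}$, and let $d\mu=db\,da\,d\vartheta/a^3$ be its left Haar measure. Write $\langle x;y\rangle=x_1y_1-x_2y_2$ and let $C_1^1,C_2^1=\{x\in\mathbb R^2: x_1^2>x_2^2,\ \pm x_1>0\}$ and $C_1^2,C_2^2=\{x\in\mathbb R^2: x_1^2<x_2^2,\ \pm x_2>0\}$. Let $\widehat G=\{\pi_i^j: i,j=1,2\}$, where $\pi_i^j$ is the unitary representation of $G$ on $L^2(C_i^j)$ given by $$(\pi_i^j(b,a,\vartheta)\varphi)(x)=a\,e^{i\langle x;b\rangle}\varphi(a\Lambda_{-\vartheta}x),$$ and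 let $K_{\pi_i^j}=K_{i,j}$ be the operator of multiplication by $\frac1{2\pi}|\langle x;x\rangle|$ on $L^2(C_i^j)$. For $1\le p<\infty$ let $L^p(G\times\widehat G,S_p)$ be the set of measurable functions $\sigma$ that assign to $(x,\pi)\in G\times\widehat G$ an operator $\sigma(x,\pi)$ in the Schatten class $S_p$ on the space of $\pi$, with $$\|\sigma\|_{p,\mu}^p=\sum_{\pi\in\widehat G}\int_G\|\sigma(x,\pi)K_\pi^{1/p}\|_{S_p}^p\,d\mu(x)<\infty ,\qquad \|A\|_{S_p}^p=\operatorname{Tr}\,(A^*A)^{p/2}.$$ For $f,g\in C_c(G)$ let $W(f,g)(x,\pi)=\int_G f(x')\,g(x'^{-1}x)\,\pi(x')\,d\mu(x')$ be the Wigner transform. The Weyl transform $W_\sigma$ with symbol $\sigma$ is defined by $$\langle W_\sigma f,\overline g\rangle=\langle W(f,g),\sigma\rangle_\mu:=\sum_{\pi\in\widehat G}\int_G\operatorname{Tr}\big(\sigma(x,\pi)^*\,W(f,g)(x,\pi)\,K_\pi\big)\,d\mu(x),\qquad f,g\in C_c(G).$$ **Theorem.** For every $2<p<\infty$ there is a $\sigma\in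 L^p(G\times\widehat G,S_p)$ such that $W_\sigma$ is not a bounded linear operator on $L^2(G)$. More precisely, for this $\sigma$ the right-hand side above converges for all $f,g\in C_c(G)$ (for each $\pi$ and almost every $x$ the operator $\sigma(x,\pi)^*W(f,g)(x,\pi)K_\pi$ extends to a trace class operator, and its trace is integrable in $x$), but there is no bounded linear operator $T$ on $L^2(G)=L^2(G,\mu)$ with $\langle Tf,\overline g\rangle=\langle W(f,g),\sigma\rangle_\mu$ for all $f,g\in C_c(G)$. -/

import Mathlib

open MeasureTheory
open scoped ENNReal InnerProductSpace

noncomputable section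

/-! ### The affine Poincare group -/

/-- The affine Poincaré group: triples `(b, a, ϑ)` with `b ∈ ℝ²`, `a > 0`, `ϑ ∈ ℝ`
(`ϑ` parametrizes the hyperbolic rotations). -/
def PAff : Type := (ℝ × ℝ) × Set.Ioi (0 : ℝ) × ℝ

/-- The topology of `ℝ² × (0, ∞) × ℝ`. -/
instance PAff.instTopologicalSpace : TopologicalSpace PAff :=
  inferInstanceAs (TopologicalSpace ((ℝ × ℝ) × Set.Ioi (0 : ℝ) × ℝ))

/-- The Borel sets of `ℝ² × (0, ∞) × ℝ`. -/
instance PAff.instMeasurableSpace : MeasurableSpace PAff :=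
  inferInstanceAs (MeasurableSpace ((ℝ × ℝ) × Set.Ioi (0 : ℝ) × ℝ))

instance PAff.instBorelSpace : BorelSpace PAff :=
  inferInstanceAs (BorelSpace ((ℝ × ℝ) × Set.Ioi (0 : ℝ) × ℝ))

namespace PAff

/-- The translation part. -/
def b (g : PAff) : ℝ × ℝ := g.1

/-- The dilation part. -/
def a (g : PAff) : ℝ := (g.2.1 : ℝ)

/-- The hyperbolic angle. -/
def th (g : PAff) : ℝ := g.2.2

lemma a_pos (g : PAff) : 0 < g.a := g.2.1.2

/-- The element `(b, a, ϑ)`. -/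
def mk (b : ℝ × ℝ) (a : ℝ) (ha : 0 < a) (t : ℝ) : PAff := (b, ⟨a, ha⟩, t)

lemma ext' {g h : PAff} (h1 : g.b = h.b) (h2 : g.a = h.a) (h3 : g.th = h.th) : g = h :=
  Prod.ext h1 (Prod.ext (Subtype.ext h2) h3)

end PAff

/-- The hyperbolic rotation `Λ_ϑ` of the plane, with matrix
`(cosh ϑ, sinh ϑ; sinh ϑ, cosh ϑ)`. -/
def hypRot (t : ℝ) (x : ℝ × ℝ) : ℝ × ℝ :=
  (Real.cosh t * x.1 + Real.sinh t * x.2, Real.sinh t * x.1 + Real.cosh t * x.2)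

lemma hypRot_hypRot (s t : ℝ) (x : ℝ × ℝ) : hypRot s (hypRot t x) = hypRot (s + t) x := by
  ext <;> simp only [hypRot, Real.cosh_add, Real.sinh_add] <;> ring

lemma hypRot_zero (x : ℝ × ℝ) : hypRot 0 x = x := by
  ext <;> simp [hypRot]

lemma hypRot_add (t : ℝ) (x y : ℝ × ℝ) : hypRot t (x + y) = hypRot t x + hypRot t y := by
  ext <;> simp only [hypRot, Prod.fst_add, Prod.snd_add] <;> ring

lemma hypRot_smul (t c : ℝ) (x : ℝ × ℝ) : hypRot t (c • x) = c • hypRot t x := by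
  ext <;> simp only [hypRot, Prod.smul_fst, Prod.smul_snd, smul_eq_mul] <;> ring

namespace PAff

/-- `(b, a, ϑ) (b', a', ϑ') = (b + a Λ_ϑ b', a a', ϑ + ϑ')`. -/
instance instMul : Mul PAff :=
  ⟨fun g h => mk (g.b + g.a • hypRot g.th h.b) (g.a * h.a) (mul_pos g.a_pos h.a_pos)
    (g.th + h.th)⟩

instance instOne : One PAff := ⟨mk 0 1 one_pos 0⟩

/-- `(b, a, ϑ)⁻¹ = (-a⁻¹ Λ_{-ϑ} b, a⁻¹, -ϑ)`. -/
instance instInv : Inv PAff :=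
  ⟨fun g => mk (-(g.a⁻¹ • hypRot (-g.th) g.b)) g.a⁻¹ (inv_pos.2 g.a_pos) (-g.th)⟩

lemma mul_b (g h : PAff) : (g * h).b = g.b + g.a • hypRot g.th h.b := rfl
lemma mul_a (g h : PAff) : (g * h).a = g.a * h.a := rfl
lemma mul_th (g h : PAff) : (g * h).th = g.th + h.th := rfl
lemma one_b : (1 : PAff).b = 0 := rfl
lemma one_a : (1 : PAff).a = 1 := rfl
lemma one_th : (1 : PAff).th = 0 := rfl
lemma inv_b (g : PAff) : (g⁻¹).b = -(g.a⁻¹ • hypRot (-g.th) g.b) := rfl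
lemma inv_a (g : PAff) : (g⁻¹).a = g.a⁻¹ := rfl
lemma inv_th (g : PAff) : (g⁻¹).th = -g.th := rfl

instance instGroup : Group PAff :=
  Group.ofLeftAxioms
    (fun g h k => ext'
      (by simp only [mul_b, mul_a, mul_th, hypRot_add, hypRot_smul, hypRot_hypRot, smul_add,
            smul_smul, add_assoc])
      (by simp only [mul_a, mul_assoc])
      (by simp only [mul_th, add_assoc]))
    (fun g => ext'
      (by simp only [mul_b, one_b, one_a, one_th, hypRot_zero, one_smul, zero_add])
      (by simp only [mul_a, one_a, one_mul])
      (by simp only [mul_th, one_th, zero_add]))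
    (fun g => ext'
      (by simp only [mul_b, inv_b, inv_a, inv_th, one_b, neg_add_cancel])
      (by simp only [mul_a, inv_a, one_a]; exact inv_mul_cancel₀ g.a_pos.ne')
      (by simp only [mul_th, inv_th, one_th, neg_add_cancel]))

/-- The measure `da` on `(0, ∞)`. -/
def dilMeasure : Measure (Set.Ioi (0 : ℝ)) := (volume : Measure ℝ).comap Subtype.val

instance instFiniteDil : IsFiniteMeasureOnCompacts dilMeasure :=
  .comap' _ continuous_subtype_val (MeasurableEmbedding.subtype_coe measurableSet_Ioi)

instance instLocDil : IsLocallyFiniteMeasure dilMeasure :=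
  haveI : LocallyCompactSpace (Set.Ioi (0 : ℝ)) := isOpen_Ioi.locallyCompactSpace
  inferInstance

/-- The measure `db da dϑ` on `ℝ² × (0, ∞) × ℝ`. -/
def lebesgue : Measure PAff :=
  (volume : Measure (ℝ × ℝ)).prod (dilMeasure.prod (volume : Measure ℝ))

instance instLocLebesgue : IsLocallyFiniteMeasure lebesgue :=
  inferInstanceAs (IsLocallyFiniteMeasure
    ((volume : Measure (ℝ × ℝ)).prod (dilMeasure.prod (volume : Measure ℝ))))

/-- The left Haar measure `db da dϑ / a³`. -/
def haar : Measure PAff := lebesgue.withDensity (fun g => ENNReal.ofReal ((g.a ^ 3)⁻¹))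

lemma continuous_a : Continuous a :=
  continuous_subtype_val.comp
    ((continuous_fst.comp continuous_snd : Continuous
      (fun g : (ℝ × ℝ) × Set.Ioi (0 : ℝ) × ℝ => g.2.1)))

instance instLocHaar : IsLocallyFiniteMeasure haar :=
  IsLocallyFiniteMeasure.withDensity_ofReal
    ((continuous_a.pow 3).inv₀ (fun g => (pow_pos g.a_pos 3).ne'))

end PAff

/-- The Hilbert space `L²(G)` with respect to the left Haar measure. -/
abbrev L2G : Type := Lp ℂ 2 PAff.haar

/-! ### The four cones and the representations -/

/-- The Minkowski inner product `⟨x; y⟩ = x₁ y₁ - x₂ y₂`. -/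
def mink (x y : ℝ × ℝ) : ℝ := x.1 * y.1 - x.2 * y.2

/-- The label set of the dual: the pair `(i, j)`, each entry in `{0, 1}`, stands for the
representation on the cone with (one-based) indices `i + 1` and `j + 1`. -/
abbrev PDual : Type := Fin 2 × Fin 2

/-- The sign attached to the first index. -/
def sgn (i : Fin 2) : ℝ := if i = 0 then 1 else -1

/-- The four open cones cut out by the light cone `x₁² = x₂²`: the right and left ones
(second index `0`) and the upper and lower ones (second index `1`). -/
def cone (r : PDual) : Set (ℝ × ℝ) :=
  if r.2 = 0 then {x | x.2 ^ 2 < x.1 ^ 2 ∧ 0 < sgn r.1 * x.1}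
  else {x | x.1 ^ 2 < x.2 ^ 2 ∧ 0 < sgn r.1 * x.2}

/-- The Hilbert space `L²(C)` of the cone `C` labelled by `r`. -/
abbrev HCone (r : PDual) : Type := Lp ℂ 2 ((volume : Measure (ℝ × ℝ)).restrict (cone r))

/-- The map `x ↦ a Λ_{-ϑ} x` of the plane. -/
def dilRot (g : PAff) (x : ℝ × ℝ) : ℝ × ℝ := g.a • hypRot (-g.th) x

lemma cosh_sinh_aux (t x y : ℝ) (h : y ^ 2 < x ^ 2) (hx : 0 < x) :
    0 < Real.cosh t * x + Real.sinh t * y := by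
  have h1 : |y| < x := by
    exact abs_lt_of_sq_lt_sq h hx.le
  have h2 : |Real.sinh t| < Real.cosh t := by
    refine abs_lt_of_sq_lt_sq ?_ (Real.cosh_pos t).le
    have := Real.cosh_sq t
    linarith
  have h3 : |Real.sinh t * y| < Real.cosh t * x := by
    rw [abs_mul]
    exact mul_lt_mul'' h2 h1 (abs_nonneg _) (abs_nonneg _)
  linarith [(abs_lt.1 h3).1]

lemma dilRot_mem (r : PDual) (g : PAff) {x : ℝ × ℝ} (hx : x ∈ cone r) : dilRot g x ∈ cone r := by
  have hid : (dilRot g x).1 ^ 2 - (dilRot g x).2 ^ 2 = g.a ^ 2 * (x.1 ^ 2 - x.2 ^ 2) := by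
    have := Real.cosh_sq (-g.th)
    simp only [dilRot, hypRot, Prod.smul_fst, Prod.smul_snd, smul_eq_mul]
    linear_combination (g.a ^ 2 * (x.1 ^ 2 - x.2 ^ 2)) * this
  have ha := g.a_pos
  have ha2 : 0 < g.a ^ 2 := by positivity
  unfold cone at hx ⊢
  split_ifs at hx ⊢ with h
  · obtain ⟨h1, h2⟩ := hx
    refine ⟨by nlinarith [mul_pos ha2 (sub_pos.2 h1)], ?_⟩
    have h4 := cosh_sinh_aux (-g.th) (sgn r.1 * x.1) (sgn r.1 * x.2)
      (by unfold sgn; split_ifs <;> nlinarith) h2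
    have h5 := mul_pos ha h4
    simp only [dilRot, hypRot, Prod.smul_fst, smul_eq_mul]
    linarith
  · obtain ⟨h1, h2⟩ := hx
    refine ⟨by nlinarith [mul_pos ha2 (sub_pos.2 h1)], ?_⟩
    have h4 := cosh_sinh_aux (-g.th) (sgn r.1 * x.2) (sgn r.1 * x.1)
      (by unfold sgn; split_ifs <;> nlinarith) h2
    have h5 := mul_pos ha h4
    simp only [dilRot, hypRot, Prod.smul_snd, smul_eq_mul]
    linarith

lemma dilRot_inv (g : PAff) (x : ℝ × ℝ) : dilRot g⁻¹ (dilRot g x) = x := by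
  simp only [dilRot, PAff.inv_a, PAff.inv_th, hypRot_smul, hypRot_hypRot, smul_smul]
  rw [inv_mul_cancel₀ g.a_pos.ne', one_smul, add_comm, add_neg_cancel, hypRot_zero]

lemma dilRot_preimage (r : PDual) (g : PAff) : dilRot g ⁻¹' cone r = cone r := by
  ext x
  refine ⟨fun h => ?_, fun h => dilRot_mem r g h⟩
  have := dilRot_mem r g⁻¹ h
  rwa [dilRot_inv] at this

lemma measurableSet_cone (r : PDual) : MeasurableSet (cone r) := by
  have hc1 : Continuous fun x : ℝ × ℝ => x.1 ^ 2 := by fun_prop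
  have hc2 : Continuous fun x : ℝ × ℝ => x.2 ^ 2 := by fun_prop
  have hc3 : Continuous fun x : ℝ × ℝ => sgn r.1 * x.1 := by fun_prop
  have hc4 : Continuous fun x : ℝ × ℝ => sgn r.1 * x.2 := by fun_prop
  unfold cone
  split_ifs
  · exact ((isOpen_lt hc2 hc1).inter (isOpen_lt continuous_const hc3)).measurableSet
  · exact ((isOpen_lt hc1 hc2).inter (isOpen_lt continuous_const hc4)).measurableSet

lemma continuous_dilRot (g : PAff) : Continuous (dilRot g) := by
  unfold dilRot hypRot
  fun_prop

/-- The matrix of `dilRot g`. -/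
def dilRotMatrix (g : PAff) : Matrix (Fin 2) (Fin 2) ℝ :=
  !![g.a * Real.cosh (-g.th), g.a * Real.sinh (-g.th);
    g.a * Real.sinh (-g.th), g.a * Real.cosh (-g.th)]

lemma map_dilRot (g : PAff) :
    Measure.map (dilRot g) (volume : Measure (ℝ × ℝ)) =
      ENNReal.ofReal ((g.a ^ 2)⁻¹) • (volume : Measure (ℝ × ℝ)) := by
  have hdet : LinearMap.det (Matrix.toLin (Module.Basis.finTwoProd ℝ)
      (Module.Basis.finTwoProd ℝ) (dilRotMatrix g)) = g.a ^ 2 := by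
    rw [LinearMap.det_toLin, dilRotMatrix, Matrix.det_fin_two_of]
    linear_combination (g.a ^ 2) * Real.cosh_sq (-g.th)
  have hfun : (Matrix.toLin (Module.Basis.finTwoProd ℝ)
      (Module.Basis.finTwoProd ℝ) (dilRotMatrix g) : ℝ × ℝ → ℝ × ℝ) = dilRot g := by
    funext x
    rw [dilRotMatrix, Matrix.toLin_finTwoProd]
    ext <;> simp [dilRot, hypRot] <;> ring
  have hpos : 0 < g.a ^ 2 := pow_pos g.a_pos 2
  have := Measure.map_linearMap_addHaar_eq_smul_addHaar (volume : Measure (ℝ × ℝ))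
    (f := Matrix.toLin (Module.Basis.finTwoProd ℝ)
      (Module.Basis.finTwoProd ℝ) (dilRotMatrix g)) (by rw [hdet]; exact hpos.ne')
  rw [hfun, hdet, abs_of_pos (inv_pos.2 hpos)] at this
  exact this

lemma map_dilRot_restrict (r : PDual) (g : PAff) :
    Measure.map (dilRot g) ((volume : Measure (ℝ × ℝ)).restrict (cone r)) =
      ENNReal.ofReal ((g.a ^ 2)⁻¹) • (volume : Measure (ℝ × ℝ)).restrict (cone r) := by
  rw [← Measure.restrict_smul, ← map_dilRot g,
    Measure.restrict_map (continuous_dilRot g).measurable (measurableSet_cone r),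
    dilRot_preimage]

/-- The function `x ↦ a e^{i⟨x; b⟩} φ(a Λ_{-ϑ} x)`. -/
def repFun (r : PDual) (g : PAff) (φ : HCone r) (x : ℝ × ℝ) : ℂ :=
  ((g.a : ℂ) * Complex.exp (Complex.I * (mink x g.b : ℂ))) * φ (dilRot g x)

lemma memLp_repFun (r : PDual) (g : PAff) (φ : HCone r) :
    MemLp (repFun r g φ) 2 ((volume : Measure (ℝ × ℝ)).restrict (cone r)) := by
  have h1 : MemLp (fun x => φ (dilRot g x)) 2
      ((volume : Measure (ℝ × ℝ)).restrict (cone r)) := by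
    refine MemLp.comp_of_map (f := dilRot g) ?_ (continuous_dilRot g).aemeasurable
    rw [map_dilRot_restrict]
    exact (Lp.memLp φ).smul_measure ENNReal.ofReal_ne_top
  refine MemLp.of_le_mul (c := g.a) h1 ?_ ?_
  · refine AEStronglyMeasurable.mul ?_ h1.1
    refine Continuous.aestronglyMeasurable ?_
    unfold mink
    fun_prop
  · refine Filter.Eventually.of_forall (fun x => ?_)
    have : ‖Complex.exp (Complex.I * (mink x g.b : ℂ))‖ = 1 := by
      rw [mul_comm]; exact Complex.norm_exp_ofReal_mul_I _
    rw [repFun, norm_mul, norm_mul, this, mul_one, Complex.norm_real, Real.norm_eq_abs,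
      abs_of_pos g.a_pos]

/-- The representation of the group on `L²(C)`:
`(π(b, a, ϑ) φ)(x) = a e^{i⟨x; b⟩} φ(a Λ_{-ϑ} x)`. -/
def rep (r : PDual) (g : PAff) (φ : HCone r) : HCone r := (memLp_repFun r g φ).toLp (repFun r g φ)

/-! ### Duflo-Moore operators, Schatten norms, traces -/

/-- The graph of the power `K^s` of the Duflo-Moore operator `K`, the operator of multiplication
by `|⟨x; x⟩| / (2π)` with its maximal domain: `φ` lies in the domain and `K^s φ = ψ`. -/
def KPowGraph (r : PDual) (s : ℝ) (φ ψ : HCone r) : Prop :=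
  ∀ᵐ x ∂((volume : Measure (ℝ × ℝ)).restrict (cone r)),
    ψ x = (((1 / (2 * Real.pi) * |mink x x|) ^ s : ℝ) : ℂ) * φ x

/-- `T` is the bounded operator that extends the densely defined operator `B K^s`. -/
def ExtendsMulK (r : PDual) (s : ℝ) (B : HCone r → HCone r) (T : HCone r →L[ℂ] HCone r) : Prop :=
  ∀ φ ψ : HCone r, KPowGraph r s φ ψ → T φ = B ψ

/-- The trace of a positive operator, as an element of `[0, ∞]`: the supremum of
`∑ ⟨e, P e⟩` over all finite orthonormal families. -/
def posTrace {E : Type} [NormedAddCommGroup E] [InnerProductSpace ℂ E] (P : E →L[ℂ] E) : ℝ≥0∞ :=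
  ⨆ (n : ℕ) (e : Fin n → E) (_ : Orthonormal ℂ e),
    ∑ k, ENNReal.ofReal (RCLike.re ⟪e k, P (e k)⟫_ℂ)

/-- `‖A‖_{S_p}^p = Tr (A* A)^{p/2}`, as an element of `[0, ∞]`. -/
def schattenPow {E : Type} [NormedAddCommGroup E] [InnerProductSpace ℂ E] [CompleteSpace E]
    (p : ℝ) (A : E →L[ℂ] E) : ℝ≥0∞ :=
  posTrace ((star A * A) ^ (p / 2))

/-- `‖B K^s‖_{S_p}^p`; it is `∞` if `B K^s` has no bounded extension. -/
def schattenPowMulK (r : PDual) (p s : ℝ) (B : HCone r → HCone r) : ℝ≥0∞ :=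
  ⨅ (T : HCone r →L[ℂ] HCone r) (_ : ExtendsMulK r s B T), schattenPow p T

/-- `T` is of trace class with trace `z`: the series `∑ ⟨e, T e⟩` converges absolutely to `z`
for every orthonormal basis. -/
def HasTrace {E : Type} [NormedAddCommGroup E] [InnerProductSpace ℂ E] (T : E →L[ℂ] E)
    (z : ℂ) : Prop :=
  ∀ (ι : Type) (e : HilbertBasis ι ℂ E), HasSum (fun k => ⟪e k, T (e k)⟫_ℂ) z

/-! ### Symbols, the Wigner transform and the Weyl transform -/

/-- Operator valued functions on the product of the group and its dual. -/
abbrev OpSymbol : Type := PAff → (r : PDual) → (HCone r →L[ℂ] HCone r)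

/-- `σ ∈ L^p(G × Ĝ, S_p)`: `σ` is (weakly) measurable, has values in the Schatten class `S_p`,
and `∑_π ∫_G ‖σ(x, π) K_π^{1/p}‖_{S_p}^p dμ(x) < ∞`. -/
structure MemLpSymbol (p : ℝ) (σ : OpSymbol) : Prop where
  measurable : ∀ (r : PDual) (φ ψ : HCone r), Measurable (fun x => ⟪ψ, σ x r φ⟫_ℂ)
  schatten : ∀ (x : PAff) (r : PDual), schattenPow p (σ x r) < ∞
  norm_lt_top : ∑ r : PDual, ∫⁻ x, schattenPowMulK r p (1 / p) (σ x r) ∂PAff.haar < ∞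

/-- The Wigner transform
`W(f, g)(x, π) φ = ∫ f(x') g(x'⁻¹ x) π(x') φ dμ(x')`, as an integral in `L²(C)`. -/
def wigner (f g : PAff → ℂ) (x : PAff) (r : PDual) (φ : HCone r) : HCone r :=
  ∫ y, (f y * g (y⁻¹ * x)) • rep r y φ ∂PAff.haar

/-- The pairing `⟨W(f, g), σ⟩_μ = ∑_π ∫_G Tr (σ(x, π)* W(f, g)(x, π) K_π) dμ(x)` converges
and has the value `z`: for almost every `x` the densely defined operator
`σ(x, π)* W(f, g)(x, π) K_π` extends to a trace class operator, and its trace `t(x, π)` is an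
integrable function of `x`. -/
def HasPairing (f g : PAff → ℂ) (σ : OpSymbol) (z : ℂ) : Prop :=
  ∃ t : PAff → PDual → ℂ,
    (∀ r : PDual, ∀ᵐ x ∂PAff.haar, ∃ T : HCone r →L[ℂ] HCone r,
      ExtendsMulK r 1 (fun φ => star (σ x r) (wigner f g x r φ)) T ∧ HasTrace T (t x r)) ∧
    (∀ r : PDual, Integrable (fun x => t x r) PAff.haar) ∧
    z = ∑ r : PDual, ∫ x, t x r ∂PAff.haar

/-- The class of a continuous compactly supported function in `L²(G)`. -/
def ccToL2 (f : PAff → ℂ) (hf : Continuous f) (hfc : HasCompactSupport f) : L2G :=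
  (hf.memLp_of_hasCompactSupport (p := 2) (μ := PAff.haar) hfc).toLp f

/-- The pairing that defines the Weyl transform `W_σ` converges for all `f, g ∈ C_c(G)`. -/
def WeylDefined (σ : OpSymbol) : Prop :=
  ∀ f g : PAff → ℂ, Continuous f → HasCompactSupport f → Continuous g → HasCompactSupport g →
    ∃ z : ℂ, HasPairing f g σ z

/-- `W_σ` is given by the bounded operator `T` on `L²(G)`: for all `f, g ∈ C_c(G)`,
`⟨T f, conj g⟩ = ∫ (T f) g dμ` is equal to `⟨W(f, g), σ⟩_μ`. -/
def IsWeylTransform (σ : OpSymbol) (T : L2G →L[ℂ] L2G) : Prop :=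
  ∀ (f g : PAff → ℂ) (hf : Continuous f) (hfc : HasCompactSupport f),
    Continuous g → HasCompactSupport g →
      HasPairing f g σ (∫ x, T (ccToL2 f hf hfc) x * g x ∂PAff.haar)

end

open MeasureTheory
open scoped ENNReal InnerProductSpace

noncomputable section

/-! ### Schatten norms of operators of rank one -/

section RankOne

variable {E : Type} [NormedAddCommGroup E] [InnerProductSpace ℂ E] [CompleteSpace E]

/-! The exponent 2 is critical because `(1 + |t|)^{-1/2}` lies in `L^p(ℝ)` for every `p > 2` but not
in `L²(ℝ)`. The symbol carries this failure into the hyperbolic angle, a non-compact direction of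
the group on which multiplication is plain addition.

Let `u` be the indicator of a ball, restricted to one cone, and let `σ(x, π) = H(x) |u⟩⟨u|` on that
single representation. Here `H` is the indicator of a compact set `B` in translation and dilation,
times `(1 + |ϑ|)^{-1/2}`. The Schatten norm of a rank one operator is a product of vector norms
(`schattenPow_rankOne_le`), so `σ ∈ L^p` reduces to `H ∈ L^p(G)`.

Pairing such a symbol with a Wigner transform gives a scalar convolution: the trace is `H(x) ∫ f(y)
c(y) g(y⁻¹x) dμ(y)` with `c(y) = ⟨u, π(y) K u⟩` (`exists_trace_rankOneSymbol`). It is determined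
uniquely because the domain of `K` is dense (`eq_of_eq_on_domain`). Moreover `c(1) = ‖K^{1/2} u‖² >
0`.

Fix a bump `f` near the identity, where `Re c > 0`, and let `g` have angular profile `(1 +
|ϑ|)^{-1/2}`, cut off near `|ϑ| = N`. Let `J(N) = ∫_{-N}^{N} dt / (1 + |t|)`. Convolution by `f c`
moves the angle by at most 1, so the pairing is at least `δ J(N)` (`exists_pairing_lower_bound`),
while `‖g‖² ≤ C J(N + 2)`. A bounded `T` would give `δ J(N) ≤ ‖T f‖ (C J(N + 2))^{1/2}` for all `N`,
which is impossible since `J(N) → ∞` and `J(N + 2) ≤ J(N) + 4`. -/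

omit [CompleteSpace E] in
lemma spectrum_nnreal_of_mul_self_eq_smul {B : E →L[ℂ] E} {c : NNReal}
    (hB : B * B = (c : ℂ) • B) {x : NNReal} (hx : x ∈ spectrum NNReal B) : x = 0 ∨ x = c := by
  have hx' : (x : ℂ) ∈ spectrum ℂ B := (spectrum.algebraMap_mem_iff ℂ).2 hx
  -- The polynomial `X² - cX` annihilates `B`, so by spectral mapping every spectral value is one of
  -- its roots.
  have h := spectrum.subset_polynomial_aeval B
    (Polynomial.X ^ 2 - Polynomial.C (c : ℂ) * Polynomial.X) ⟨_, hx', rfl⟩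
  have h0 : Polynomial.aeval B (Polynomial.X ^ 2 - Polynomial.C (c : ℂ) * Polynomial.X) = 0 := by
    simp [sq, hB, Algebra.algebraMap_eq_smul_one]
  rw [h0] at h
  have hnt : Nontrivial (E →L[ℂ] E) := by
    by_contra hn
    rw [not_nontrivial_iff_subsingleton] at hn
    simp [spectrum.of_subsingleton] at h
  simp only [spectrum.zero_eq, Set.mem_singleton_iff] at h
  simp only [Polynomial.eval_sub, Polynomial.eval_X, Polynomial.eval_mul,
    Polynomial.eval_C, sub_eq_zero, sq, mul_eq_mul_right_iff] at h
  rcases h with h | h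
  · exact Or.inr (by exact_mod_cast h)
  · exact Or.inl (by exact_mod_cast h)

/-- On the spectrum, contained in `{0, c}`, the functions `t^s` and `c^{s-1} t` agree; `s ≠ 0` is
what makes `0^s = 0`. -/
lemma rpow_of_mul_self_eq_smul {B : E →L[ℂ] E} (hB0 : 0 ≤ B) {c : NNReal}
    (hB : B * B = (c : ℂ) • B) {s : ℝ} (hs : s ≠ 0) : B ^ s = (c ^ (s - 1)) • B := by
  rw [CFC.rpow_def, ← cfc_const_mul_id (c ^ (s - 1)) B]
  refine cfc_congr fun x hx => ?_
  rcases spectrum_nnreal_of_mul_self_eq_smul hB hx with rfl | rfl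
  · simp [NNReal.zero_rpow hs]
  · rcases eq_or_ne x 0 with rfl | h
    · simp [NNReal.zero_rpow hs]
    · change x ^ s = x ^ (s - 1) * x
      rw [NNReal.rpow_sub_one h, div_mul_cancel₀ _ h]

lemma star_rankOne_mul_rankOne (u w : E) :
    star (InnerProductSpace.rankOne ℂ u w) * InnerProductSpace.rankOne ℂ u w =
      ((‖u‖ ^ 2 : ℝ) : ℂ) • InnerProductSpace.rankOne ℂ w w := by
  rw [ContinuousLinearMap.star_eq_adjoint, InnerProductSpace.adjoint_rankOne]
  ext z
  simp [inner_self_eq_norm_sq_to_K, smul_smul, mul_comm]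

/-- For `A = |u⟩⟨w|` the operator `A*A = ‖u‖² |w⟩⟨w|` squares to `c A*A` with `c = (‖u‖‖w‖)²`, so
its power is again a multiple of `|w⟩⟨w|`. Bessel's inequality bounds the trace of the latter by
`‖w‖²`. -/
lemma schattenPow_rankOne_le {p : ℝ} (hp : 0 < p) (u w : E) :
    schattenPow p (InnerProductSpace.rankOne ℂ u w) ≤ ENNReal.ofReal ((‖u‖ * ‖w‖) ^ p) := by
  set c : NNReal := (‖u‖₊ * ‖w‖₊) ^ 2 with hc
  have h1 : star (InnerProductSpace.rankOne ℂ u w) * InnerProductSpace.rankOne ℂ u w *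
      (star (InnerProductSpace.rankOne ℂ u w) * InnerProductSpace.rankOne ℂ u w) =
      (c : ℂ) • (star (InnerProductSpace.rankOne ℂ u w) * InnerProductSpace.rankOne ℂ u w) := by
    rw [star_rankOne_mul_rankOne]
    ext z
    simp [inner_self_eq_norm_sq_to_K, smul_smul, hc]
    congr 1
    ring
  have hpos : (0 : E →L[ℂ] E) ≤
      star (InnerProductSpace.rankOne ℂ u w) * InnerProductSpace.rankOne ℂ u w :=
    star_mul_self_nonneg _
  unfold schattenPow
  rw [rpow_of_mul_self_eq_smul hpos h1 (by positivity), star_rankOne_mul_rankOne]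
  refine iSup_le fun n => iSup_le fun e => iSup_le fun he => ?_
  have hterm : ∀ k, RCLike.re ⟪e k, (c ^ (p / 2 - 1) •
      (((‖u‖ ^ 2 : ℝ) : ℂ) • InnerProductSpace.rankOne ℂ w w)) (e k)⟫_ℂ =
      (c : ℝ) ^ (p / 2 - 1) * ‖u‖ ^ 2 * ‖⟪e k, w⟫_ℂ‖ ^ 2 := by
    intro k
    have : ((c ^ (p / 2 - 1) •
      (((‖u‖ ^ 2 : ℝ) : ℂ) • InnerProductSpace.rankOne ℂ w w)) (e k)) =
      (((c : ℝ) ^ (p / 2 - 1) * ‖u‖ ^ 2 : ℝ) : ℂ) • (⟪w, e k⟫_ℂ • w) := by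
      simp [NNReal.smul_def, smul_smul, mul_assoc]
      rw [← Complex.coe_smul, smul_smul]
    have hconj : (starRingEnd ℂ) ⟪e k, w⟫_ℂ * ⟪e k, w⟫_ℂ = ((‖⟪e k, w⟫_ℂ‖ ^ 2 : ℝ) : ℂ) := by
      rw [mul_comm, Complex.mul_conj, Complex.normSq_eq_norm_sq]
    rw [this, inner_smul_right, inner_smul_right, ← inner_conj_symm w (e k), hconj,
      ← Complex.ofReal_mul]
    exact Complex.ofReal_re _
  simp_rw [hterm]
  rw [← ENNReal.ofReal_sum_of_nonneg (fun k _ => by positivity), ← Finset.mul_sum]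
  refine ENNReal.ofReal_le_ofReal ?_
  have hbes : ∑ k, ‖⟪e k, w⟫_ℂ‖ ^ 2 ≤ ‖w‖ ^ 2 := he.sum_inner_products_le w
  refine (mul_le_mul_of_nonneg_left hbes (by positivity)).trans (le_of_eq ?_)
  have hcr : (c : ℝ) = (‖u‖ * ‖w‖) ^ 2 := by simp [hc]
  rw [mul_assoc, ← mul_pow, hcr]
  rcases (mul_nonneg (norm_nonneg u) (norm_nonneg w)).eq_or_lt with h | h
  · rw [← h]; simp [hp.ne']
  · rw [Real.rpow_sub_one (by positivity), div_mul_cancel₀ _ (by positivity),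
      ← Real.rpow_natCast, ← Real.rpow_mul h.le]
    congr 1
    push_cast
    ring

-- Apply `L` termwise to the expansion of `v` in the basis: `⟪e_k, L(e_k) v⟫ = L(⟪e_k, v⟫ e_k)`.
omit [CompleteSpace E] in
lemma hasTrace_smulRight (L : E →L[ℂ] ℂ) (v : E) : HasTrace (L.smulRight v) (L v) := by
  intro ι e
  have h := (e.hasSum_repr v).mapL L
  simpa [inner_smul_right, e.repr_apply_apply, mul_comm] using h

/-- `HasTrace` quantifies over all Hilbert bases, so the existence of at least one is what keeps it
from being vacuous. -/
lemma HasTrace.unique {T : E →L[ℂ] E} {z z' : ℂ} (h : HasTrace T z) (h' : HasTrace T z') :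
    z = z' := by
  obtain ⟨w, b, -⟩ := exists_hilbertBasis ℂ E
  exact (h w b).unique (h' w b)

end RankOne

/-! ### The topology of the group and its Haar measure -/

namespace PAff

instance : T2Space PAff := inferInstanceAs (T2Space ((ℝ × ℝ) × Set.Ioi (0 : ℝ) × ℝ))

instance : SecondCountableTopology PAff :=
  inferInstanceAs (SecondCountableTopology ((ℝ × ℝ) × Set.Ioi (0 : ℝ) × ℝ))

instance : LocallyCompactSpace (Set.Ioi (0 : ℝ)) := isOpen_Ioi.locallyCompactSpace

instance : LocallyCompactSpace PAff :=
  inferInstanceAs (LocallyCompactSpace ((ℝ × ℝ) × Set.Ioi (0 : ℝ) × ℝ))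

@[fun_prop]
lemma continuous_b : Continuous b :=
  (continuous_fst : Continuous (fun g : (ℝ × ℝ) × Set.Ioi (0 : ℝ) × ℝ => g.1))

attribute [fun_prop] continuous_a

@[fun_prop]
lemma continuous_th : Continuous th :=
  (continuous_snd.comp continuous_snd :
    Continuous (fun g : (ℝ × ℝ) × Set.Ioi (0 : ℝ) × ℝ => g.2.2))

lemma continuous_of_coords {X : Type*} [TopologicalSpace X] {F : X → PAff}
    (hb : Continuous fun x => (F x).b) (ha : Continuous fun x => (F x).a)
    (ht : Continuous fun x => (F x).th) : Continuous F := by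
  have h : Continuous (fun x => (((F x).b, ⟨(F x).a, (F x).a_pos⟩, (F x).th) :
      (ℝ × ℝ) × Set.Ioi (0 : ℝ) × ℝ)) :=
    hb.prodMk ((ha.subtype_mk fun x => (F x).a_pos).prodMk ht)
  exact h

instance : ContinuousMul PAff := ⟨by
  refine continuous_of_coords ?_ ?_ ?_
  · simp only [mul_b, hypRot]; fun_prop
  · simp only [mul_a]; fun_prop
  · simp only [mul_th]; fun_prop⟩

instance : ContinuousInv PAff := ⟨by
  have ha : Continuous fun g : PAff => g.a⁻¹ := continuous_a.inv₀ fun g => g.a_pos.ne'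
  refine continuous_of_coords ?_ ?_ ?_
  · simp only [inv_b, hypRot]; fun_prop
  · simpa only [inv_a] using ha
  · simp only [inv_th]; fun_prop⟩

instance : IsTopologicalGroup PAff where

end PAff

/-! ### The representations -/

lemma continuous_dilRot_uncurry : Continuous fun q : PAff × (ℝ × ℝ) => dilRot q.1 q.2 := by
  unfold dilRot hypRot
  fun_prop

lemma ae_comp_dilRot (r : PDual) (y : PAff) {P : ℝ × ℝ → Prop}
    (h : ∀ᵐ x ∂((volume : Measure (ℝ × ℝ)).restrict (cone r)), P x) :
    ∀ᵐ x ∂((volume : Measure (ℝ × ℝ)).restrict (cone r)), P (dilRot y x) := by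
  refine ae_of_ae_map (continuous_dilRot y).aemeasurable ?_
  rw [map_dilRot_restrict]
  exact Measure.ae_smul_measure h _

lemma coe_rep (r : PDual) (y : PAff) (φ : HCone r) :
    rep r y φ =ᵐ[(volume : Measure (ℝ × ℝ)).restrict (cone r)] repFun r y φ :=
  MemLp.coeFn_toLp _

lemma rep_add (r : PDual) (y : PAff) (φ ψ : HCone r) :
    rep r y (φ + ψ) = rep r y φ + rep r y ψ := by
  refine Lp.ext ?_
  filter_upwards [coe_rep r y (φ + ψ), coe_rep r y φ, coe_rep r y ψ,
    Lp.coeFn_add (rep r y φ) (rep r y ψ), ae_comp_dilRot r y (Lp.coeFn_add φ ψ)] with x h1 h2 h3 h4 h5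
  rw [h4, Pi.add_apply, h1, h2, h3, repFun, repFun, repFun, h5, Pi.add_apply, mul_add]

lemma rep_smul (r : PDual) (y : PAff) (c : ℂ) (φ : HCone r) :
    rep r y (c • φ) = c • rep r y φ := by
  refine Lp.ext ?_
  filter_upwards [coe_rep r y (c • φ), coe_rep r y φ,
    Lp.coeFn_smul c (rep r y φ), ae_comp_dilRot r y (Lp.coeFn_smul c φ)] with x h1 h2 h4 h5
  rw [h4, Pi.smul_apply, h1, h2, repFun, repFun, h5, Pi.smul_apply, smul_eq_mul, smul_eq_mul]
  ring

lemma norm_repFun (r : PDual) (y : PAff) (φ : HCone r) (x : ℝ × ℝ) :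
    ‖repFun r y φ x‖ = ‖y.a • φ (dilRot y x)‖ := by
  have : ‖Complex.exp (Complex.I * (mink x y.b : ℂ))‖ = 1 := by
    rw [mul_comm]; exact Complex.norm_exp_ofReal_mul_I _
  rw [repFun, norm_mul, norm_mul, this, mul_one, Complex.norm_real, norm_smul]

/-- The phase has modulus one, and the factor `a` cancels the square root of the Jacobian factor
`a⁻²`. -/
lemma norm_rep (r : PDual) (y : PAff) (φ : HCone r) : ‖rep r y φ‖ = ‖φ‖ := by
  have h1 : eLpNorm (repFun r y φ) 2 ((volume : Measure (ℝ × ℝ)).restrict (cone r)) =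
      ‖y.a‖ₑ * eLpNorm (φ ∘ dilRot y) 2 ((volume : Measure (ℝ × ℝ)).restrict (cone r)) := by
    rw [← eLpNorm_const_smul]
    exact eLpNorm_congr_norm_ae (Filter.Eventually.of_forall fun x => norm_repFun r y φ x)
  have h2 : AEStronglyMeasurable φ
      (Measure.map (dilRot y) ((volume : Measure (ℝ × ℝ)).restrict (cone r))) := by
    rw [map_dilRot_restrict]
    exact (Lp.aestronglyMeasurable φ).smul_measure _
  rw [← eLpNorm_map_measure h2 (continuous_dilRot y).aemeasurable, map_dilRot_restrict,
    eLpNorm_smul_measure_of_ne_top (by simp)] at h1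
  have ha := y.a_pos
  have h3 : ‖y.a‖ₑ * ENNReal.ofReal (y.a ^ 2)⁻¹ ^ (1 / (2 : ℝ≥0∞)).toReal = 1 := by
    rw [Real.enorm_eq_ofReal ha.le, ENNReal.ofReal_rpow_of_nonneg (by positivity) (by positivity),
      ← ENNReal.ofReal_mul ha.le]
    have : ((y.a ^ 2)⁻¹) ^ (1 / (2 : ℝ≥0∞)).toReal = y.a⁻¹ := by
      rw [← inv_pow]
      simp only [one_div, ENNReal.toReal_inv, ENNReal.toReal_ofNat]
      exact Real.pow_rpow_inv_natCast (n := 2) (by positivity) (by norm_num)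
    rw [this, mul_inv_cancel₀ ha.ne', ENNReal.ofReal_one]
  rw [rep, Lp.norm_toLp, h1, smul_eq_mul, ← mul_assoc, h3, one_mul, Lp.norm_def]

/-- The representation as a family of linear isometries. -/
def repIsometry (r : PDual) (y : PAff) : HCone r →ₗᵢ[ℂ] HCone r where
  toFun := rep r y
  map_add' := rep_add r y
  map_smul' := rep_smul r y
  norm_map' := norm_rep r y

lemma norm_sq_eq_integral {α : Type*} [MeasurableSpace α] {μ : Measure α} (φ : Lp ℂ 2 μ) :
    ‖φ‖ ^ 2 = ∫ x, ‖φ x‖ ^ 2 ∂μ := by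
  have h := L2.inner_def (𝕜 := ℂ) φ φ
  simp only [inner_self_eq_norm_sq_to_K] at h
  have h2 : ∀ x, ((‖φ x‖ : ℂ)) ^ 2 = ((‖φ x‖ ^ 2 : ℝ) : ℂ) := fun x => by push_cast; rfl
  have h3 : ((‖φ‖ ^ 2 : ℝ) : ℂ) = ((∫ x, ‖φ x‖ ^ 2 ∂μ : ℝ) : ℂ) := by
    rw [← integral_complex_ofReal, ← integral_congr_ae (Filter.Eventually.of_forall h2)]
    push_cast
    exact h
  exact_mod_cast h3

/-- For `y` in a compact neighbourhood all the functions `F y` live on one compact set, so `‖π(y)g -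
π(y₀)g‖²` is a continuous parameter integral that vanishes at `y₀`. -/
lemma continuous_rep_toLp (r : PDual) {g : ℝ × ℝ → ℂ} (hg : Continuous g)
    (hgc : HasCompactSupport g)
    (hm : MemLp g 2 ((volume : Measure (ℝ × ℝ)).restrict (cone r))) :
    Continuous fun y => rep r y (hm.toLp g) := by
  set F : PAff → ℝ × ℝ → ℂ := fun y x =>
    ((y.a : ℂ) * Complex.exp (Complex.I * (mink x y.b : ℂ))) * g (dilRot y x) with hF
  have hFc : Continuous (Function.uncurry F) := by
    have h := hg.comp continuous_dilRot_uncurry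
    simp only [Function.comp_def] at h
    simp only [hF, Function.uncurry_def, mink]
    refine Continuous.mul ?_ h
    fun_prop
  have hFr : ∀ y, rep r y (hm.toLp g) =ᵐ[(volume : Measure (ℝ × ℝ)).restrict (cone r)] F y := by
    intro y
    filter_upwards [coe_rep r y (hm.toLp g), ae_comp_dilRot r y hm.coeFn_toLp] with x h1 h2
    rw [h1, repFun, h2]
  rw [continuous_iff_continuousAt]
  intro y₀
  obtain ⟨s, hs, hsn⟩ := exists_compact_mem_nhds y₀
  have hK : IsCompact ((fun q : PAff × (ℝ × ℝ) => dilRot q.1⁻¹ q.2) '' (s ×ˢ tsupport g)) :=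
    (hs.prod hgc).image (continuous_dilRot_uncurry.comp
      ((continuous_fst.inv).prodMk continuous_snd))
  have hzero : ∀ y ∈ s, ∀ x,
      x ∉ (fun q : PAff × (ℝ × ℝ) => dilRot q.1⁻¹ q.2) '' (s ×ˢ tsupport g) → F y x = 0 := by
    intro y hy x hx
    have : g (dilRot y x) = 0 := by
      by_contra h
      exact hx ⟨(y, dilRot y x), ⟨hy, subset_tsupport g h⟩, dilRot_inv y x⟩
    simp [hF, this]
  have hcont := continuousOn_integral_of_compact_support
    (μ := (volume : Measure (ℝ × ℝ)).restrict (cone r))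
    (f := fun y x => ‖F y x - F y₀ x‖ ^ 2) (s := s) hK (by
      refine Continuous.continuousOn ?_
      have h0 : Continuous fun q : PAff × (ℝ × ℝ) => F q.1 q.2 := hFc
      have h1 : Continuous fun q : PAff × (ℝ × ℝ) => F y₀ q.2 :=
        h0.comp (continuous_const.prodMk continuous_snd)
      exact (h0.sub h1).norm.pow 2) (by
      intro y x hy hx
      simp [hzero y hy x hx, hzero y₀ (mem_of_mem_nhds hsn) x hx])
  have hat := hcont.continuousAt hsn
  have hnorm : ∀ y, ‖rep r y (hm.toLp g) - rep r y₀ (hm.toLp g)‖ ^ 2 =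
      ∫ x, ‖F y x - F y₀ x‖ ^ 2 ∂((volume : Measure (ℝ × ℝ)).restrict (cone r)) := by
    intro y
    rw [norm_sq_eq_integral]
    refine integral_congr_ae ?_
    filter_upwards [hFr y, hFr y₀, Lp.coeFn_sub (rep r y (hm.toLp g)) (rep r y₀ (hm.toLp g))]
      with x h1 h2 h3
    rw [h3, Pi.sub_apply, h1, h2]
  rw [ContinuousAt, tendsto_iff_norm_sub_tendsto_zero]
  have h4 : Filter.Tendsto (fun y => ‖rep r y (hm.toLp g) - rep r y₀ (hm.toLp g)‖ ^ 2)
      (nhds y₀) (nhds 0) := by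
    simp_rw [hnorm]
    simpa [ContinuousAt] using hat
  simpa using h4.sqrt

/-- Since each `π(y)` is an isometry, approximating `φ` by `C_c` functions approximates the orbit
map uniformly in `y`. -/
lemma continuous_rep (r : PDual) (φ : HCone r) : Continuous fun y => rep r y φ := by
  refine continuous_of_uniform_approx_of_continuous fun u hu => ?_
  obtain ⟨ε, hε, hεu⟩ := Metric.mem_uniformity_dist.1 hu
  obtain ⟨g, hgc, hle, hg, hm⟩ := (Lp.memLp φ).exists_hasCompactSupport_eLpNorm_sub_le
    (by simp) (ε := ENNReal.ofReal (ε / 2)) (by simpa using hε)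
  refine ⟨fun y => rep r y (hm.toLp g), continuous_rep_toLp r hg hgc hm, fun y => ?_⟩
  refine hεu ?_
  change dist (repIsometry r y φ) (repIsometry r y (hm.toLp g)) < ε
  rw [(repIsometry r y).dist_map, dist_eq_norm, Lp.norm_def]
  have h : eLpNorm (φ - hm.toLp g : HCone r) 2 ((volume : Measure (ℝ × ℝ)).restrict (cone r)) ≤
      ENNReal.ofReal (ε / 2) := by
    refine (eLpNorm_congr_ae ?_).trans_le hle
    filter_upwards [Lp.coeFn_sub φ (hm.toLp g), hm.coeFn_toLp] with x h1 h2
    rw [h1, Pi.sub_apply, h2, Pi.sub_apply]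
  have := ENNReal.toReal_mono (by simp) h
  rw [ENNReal.toReal_ofReal (by linarith)] at this
  linarith

/-! ### The Duflo-Moore operators -/

/-- The function `|⟨x; x⟩| / (2π)`. -/
def kfun (x : ℝ × ℝ) : ℝ := 1 / (2 * Real.pi) * |mink x x|

lemma kfun_nonneg (x : ℝ × ℝ) : 0 ≤ kfun x := by
  unfold kfun
  positivity

@[fun_prop]
lemma continuous_kfun : Continuous kfun := by
  unfold kfun mink
  fun_prop

lemma kfun_dilRot (y : PAff) (x : ℝ × ℝ) : kfun (dilRot y x) = y.a ^ 2 * kfun x := by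
  have h : mink (dilRot y x) (dilRot y x) = y.a ^ 2 * mink x x := by
    have := Real.cosh_sq (-y.th)
    simp only [mink, dilRot, hypRot, Prod.smul_fst, Prod.smul_snd, smul_eq_mul]
    linear_combination (y.a ^ 2 * (x.1 ^ 2 - x.2 ^ 2)) * this
  rw [kfun, kfun, h, abs_mul, abs_of_nonneg (sq_nonneg _)]
  ring

lemma kPowGraph_one_iff {r : PDual} {φ ψ : HCone r} : KPowGraph r 1 φ ψ ↔
    ∀ᵐ x ∂((volume : Measure (ℝ × ℝ)).restrict (cone r)), ψ x = (kfun x : ℂ) * φ x := by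
  simp only [KPowGraph, Real.rpow_one, kfun]

lemma KPowGraph.inner_eq {r : PDual} {s : ℝ} {φ ψ φ' ψ' : HCone r} (h : KPowGraph r s φ ψ)
    (h' : KPowGraph r s φ' ψ') : ⟪φ', ψ⟫_ℂ = ⟪ψ', φ⟫_ℂ := by
  rw [L2.inner_def, L2.inner_def]
  refine integral_congr_ae ?_
  filter_upwards [h, h'] with x h1 h2
  simp only [h1, h2, RCLike.inner_apply, map_mul, Complex.conj_ofReal]
  ring

/-- The semi-invariance `π(y) K = a² K π(y)` of the Duflo-Moore operator, which comes from `⟨x; x⟩`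
being Lorentz invariant and homogeneous of degree two. -/
lemma KPowGraph.rep {r : PDual} {φ ψ : HCone r} (h : KPowGraph r 1 φ ψ) (y : PAff) :
    KPowGraph r 1 (((y.a ^ 2 : ℝ) : ℂ) • rep r y φ) (rep r y ψ) := by
  rw [kPowGraph_one_iff] at *
  filter_upwards [coe_rep r y φ, coe_rep r y ψ, ae_comp_dilRot r y h,
    Lp.coeFn_smul (((y.a ^ 2 : ℝ) : ℂ)) (_root_.rep r y φ)] with x h1 h2 h3 h4
  rw [h2, h4, Pi.smul_apply, h1, repFun, repFun, h3, kfun_dilRot]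
  push_cast
  rw [smul_eq_mul]
  ring

/-- This is density of the domain of `K`: a vector orthogonal to a closed subspace containing the
domain must vanish. -/
lemma eq_of_eq_on_domain {r : PDual} {S T : HCone r →L[ℂ] HCone r}
    (h : ∀ φ ψ : HCone r, KPowGraph r 1 φ ψ → S φ = T φ) : S = T := by
  rw [← sub_eq_zero]
  set D := S - T with hD
  have hker : LinearMap.ker (D : HCone r →ₗ[ℂ] HCone r) = ⊤ := by
    have hcl : IsClosed (LinearMap.ker (D : HCone r →ₗ[ℂ] HCone r) : Set (HCone r)) :=
      D.isClosed_ker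
    have : CompleteSpace (LinearMap.ker (D : HCone r →ₗ[ℂ] HCone r)) :=
      hcl.completeSpace_coe
    rw [← Submodule.orthogonal_eq_bot_iff, Submodule.eq_bot_iff]
    intro ψ hψ
    -- With `m² = (1 + k)⁻¹` the vector `m²ψ` is in the domain of `K`, and `⟪m²ψ, ψ⟫ = ‖mψ‖²`;
    -- orthogonality then forces `ψ = 0`.
    set m : ℝ × ℝ → ℝ := fun x => (Real.sqrt (1 + kfun x))⁻¹ with hm
    have hpos : ∀ x, 0 < 1 + kfun x := fun x => by linarith [kfun_nonneg x]
    have hmpos : ∀ x, 0 < m x := fun x => inv_pos.2 (Real.sqrt_pos.2 (hpos x))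
    have hmc : Continuous m :=
      Continuous.inv₀ (by fun_prop) fun x => (Real.sqrt_pos.2 (hpos x)).ne'
    have hm2 : ∀ x, m x ^ 2 = (1 + kfun x)⁻¹ := fun x => by
      rw [hm, inv_pow, Real.sq_sqrt (hpos x).le]
    have hm1 : ∀ x, m x ≤ 1 := fun x =>
      inv_le_one_of_one_le₀ (Real.one_le_sqrt.2 (by linarith [kfun_nonneg x]))
    have hmul : ∀ c : ℝ × ℝ → ℝ, Continuous c → (∀ x, 0 ≤ c x) → (∀ x, c x ≤ 1) →
        MemLp (fun x => (c x : ℂ) * ψ x) 2 ((volume : Measure (ℝ × ℝ)).restrict (cone r)) := by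
      intro c hc hc0 hc1
      refine (Lp.memLp ψ).of_le ?_ ?_
      · exact (by fun_prop : Continuous fun x => (c x : ℂ)).aestronglyMeasurable.mul
          (Lp.aestronglyMeasurable ψ)
      · refine Filter.Eventually.of_forall fun x => ?_
        rw [norm_mul, Complex.norm_real, Real.norm_of_nonneg (hc0 x)]
        exact mul_le_of_le_one_left (norm_nonneg _) (hc1 x)
    have hφ := hmul (fun x => m x ^ 2) (hmc.pow 2) (fun x => by positivity)
      (fun x => pow_le_one₀ (hmpos x).le (hm1 x))
    have hKφ := hmul (fun x => kfun x * m x ^ 2) (continuous_kfun.mul (hmc.pow 2))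
      (fun x => mul_nonneg (kfun_nonneg x) (by positivity)) (fun x => by
        rw [hm2, ← div_eq_mul_inv, div_le_one (hpos x)]
        linarith)
    have hχ := hmul m hmc (fun x => (hmpos x).le) hm1
    have hmem : hφ.toLp _ ∈ LinearMap.ker (D : HCone r →ₗ[ℂ] HCone r) := by
      have hg : KPowGraph r 1 (hφ.toLp _) (hKφ.toLp _) := by
        rw [kPowGraph_one_iff]
        filter_upwards [hφ.coeFn_toLp, hKφ.coeFn_toLp] with x h1 h2
        rw [h1, h2]
        push_cast
        ring
      exact sub_eq_zero.2 (h _ _ hg)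
    have hin : ⟪hφ.toLp _, ψ⟫_ℂ = 0 := hψ _ hmem
    have hin2 : ⟪hφ.toLp _, ψ⟫_ℂ = ⟪hχ.toLp _, hχ.toLp _⟫_ℂ := by
      rw [L2.inner_def, L2.inner_def]
      refine integral_congr_ae ?_
      filter_upwards [hφ.coeFn_toLp, hχ.coeFn_toLp] with x h1 h2
      simp only [h1, h2, RCLike.inner_apply, map_mul, Complex.conj_ofReal]
      push_cast
      ring
    have hχ0 : hχ.toLp _ = 0 := inner_self_eq_zero.1 (hin2.symm.trans hin)
    refine (Lp.eq_zero_iff_ae_eq_zero).2 ?_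
    filter_upwards [hχ.coeFn_toLp, (Lp.eq_zero_iff_ae_eq_zero).1 hχ0] with x h1 h2
    have h3 := h1.symm.trans h2
    simpa [(hmpos x).ne'] using h3
  ext1 φ
  have : φ ∈ LinearMap.ker (D : HCone r →ₗ[ℂ] HCone r) := hker ▸ Submodule.mem_top
  simpa using this

/-! ### The Wigner transform and symbols of rank one -/

lemma continuous_wigner_integrand {f g : PAff → ℂ} (hf : Continuous f) (hg : Continuous g)
    (x : PAff) (r : PDual) (φ : HCone r) :
    Continuous fun y => (f y * g (y⁻¹ * x)) • rep r y φ :=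
  (hf.mul (hg.comp (by fun_prop))).smul (continuous_rep r φ)

lemma integrable_wigner_integrand {f g : PAff → ℂ} (hf : Continuous f) (hfc : HasCompactSupport f)
    (hg : Continuous g) (x : PAff) (r : PDual) (φ : HCone r) :
    Integrable (fun y => (f y * g (y⁻¹ * x)) • rep r y φ) PAff.haar :=
  (continuous_wigner_integrand hf hg x r φ).integrable_of_hasCompactSupport
    (hfc.mul_right.smul_right)

/-- The Wigner transform of functions in `C_c(G)` as a bounded operator. -/
def wignerCLM {f g : PAff → ℂ} (hf : Continuous f) (hfc : HasCompactSupport f)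
    (hg : Continuous g) (x : PAff) (r : PDual) : HCone r →L[ℂ] HCone r :=
  LinearMap.mkContinuous
    { toFun := wigner f g x r
      map_add' := fun φ ψ => by
        simp only [wigner, rep_add, smul_add]
        exact integral_add (integrable_wigner_integrand hf hfc hg x r φ)
          (integrable_wigner_integrand hf hfc hg x r ψ)
      map_smul' := fun c φ => by
        simp only [wigner, rep_smul, RingHom.id_apply]
        rw [← integral_smul]
        simp only [smul_comm c] }
    (∫ y, ‖f y * g (y⁻¹ * x)‖ ∂PAff.haar) (fun φ => by
      refine (norm_integral_le_integral_norm _).trans (le_of_eq ?_)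
      rw [← integral_mul_const]
      simp only [norm_smul, norm_rep])

lemma wignerCLM_apply {f g : PAff → ℂ} (hf : Continuous f) (hfc : HasCompactSupport f)
    (hg : Continuous g) (x : PAff) (r : PDual) (φ : HCone r) :
    wignerCLM hf hfc hg x r φ = wigner f g x r φ := rfl

lemma inner_wigner {f g : PAff → ℂ} (hf : Continuous f) (hfc : HasCompactSupport f)
    (hg : Continuous g) (x : PAff) (r : PDual) (u φ : HCone r) :
    ⟪u, wigner f g x r φ⟫_ℂ = ∫ y, f y * g (y⁻¹ * x) * ⟪u, rep r y φ⟫_ℂ ∂PAff.haar := by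
  rw [wigner, ← integral_inner (integrable_wigner_integrand hf hfc hg x r φ)]
  simp only [inner_smul_right]

/-- The symbol `x ↦ H(x, π) |u_π⟩⟨v_π|`. -/
def rankOneSymbol (H : PAff → PDual → ℝ) (u v : (r : PDual) → HCone r) : OpSymbol :=
  fun x r => InnerProductSpace.rankOne ℂ ((H x r : ℂ) • u r) (v r)

/-- The matrix coefficient `⟨u, π(y) K v⟩ = a² ⟨w, π(y) v⟩`, where `w = K u`. -/
def coeffK (r : PDual) (w v : HCone r) (y : PAff) : ℂ := ((y.a ^ 2 : ℝ) : ℂ) * ⟪w, rep r y v⟫_ℂ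

lemma continuous_coeffK (r : PDual) (w v : HCone r) : Continuous (coeffK r w v) := by
  have h : Continuous fun y => ⟪w, rep r y v⟫_ℂ := continuous_const.inner (continuous_rep r v)
  unfold coeffK
  fun_prop

/-- The trace of the operator in the pairing of a Wigner transform with a symbol of rank one. -/
def pairingTrace (H : PAff → PDual → ℝ) (w v : (r : PDual) → HCone r) (f g : PAff → ℂ)
    (x : PAff) (r : PDual) : ℂ :=
  (H x r : ℂ) * ∫ y, f y * coeffK r (w r) (v r) y * g (y⁻¹ * x) ∂PAff.haar

/-! ### Traces and integrability in the pairing with a rank one symbol. -/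

section Pairing

variable {H : PAff → PDual → ℝ} {u v w : (r : PDual) → HCone r}

/-- Semi-invariance and symmetry of `K` move it from the argument onto `u`, at the price of a factor
`a²`. This leaves a bounded functional times the fixed vector `v`, whose trace is the functional at
`v`. -/
lemma exists_trace_rankOneSymbol (huw : ∀ r, KPowGraph r 1 (u r) (w r)) {f g : PAff → ℂ}
    (hf : Continuous f) (hfc : HasCompactSupport f) (hg : Continuous g) (x : PAff) (r : PDual) :
    ∃ T : HCone r →L[ℂ] HCone r,
      ExtendsMulK r 1 (fun φ => star (rankOneSymbol H u v x r) (wigner f g x r φ)) T ∧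
      HasTrace T (pairingTrace H w v f g x r) := by
  -- The unbounded factor `a²` is absorbed into `f`, which stays in `C_c(G)`; the functional is
  -- therefore bounded.
  have hf' : Continuous fun y : PAff => f y * ((y.a ^ 2 : ℝ) : ℂ) := by fun_prop
  have hfc' : HasCompactSupport fun y : PAff => f y * ((y.a ^ 2 : ℝ) : ℂ) := hfc.mul_right
  set L : HCone r →L[ℂ] ℂ := (H x r : ℂ) • (innerSL ℂ (w r)) ∘L wignerCLM hf' hfc' hg x r with hL
  have hLa : ∀ φ, L φ =
      (H x r : ℂ) * ⟪w r, wigner (fun y : PAff => f y * ((y.a ^ 2 : ℝ) : ℂ)) g x r φ⟫_ℂ := by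
    intro φ
    simp [hL, wignerCLM_apply]
  refine ⟨L.smulRight (v r), ?_, ?_⟩
  · intro φ ψ hφ
    simp only [rankOneSymbol, ContinuousLinearMap.star_eq_adjoint,
      InnerProductSpace.adjoint_rankOne]
    rw [InnerProductSpace.rankOne_apply, ContinuousLinearMap.smulRight_apply, hLa, inner_smul_left,
      Complex.conj_ofReal, inner_wigner hf hfc hg, inner_wigner hf' hfc' hg]
    congr 2
    refine integral_congr_ae (Filter.Eventually.of_forall fun y => ?_)
    simp only
    rw [(hφ.rep y).inner_eq (huw r), inner_smul_right]
    ring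
  · convert hasTrace_smulRight L (v r) using 1
    rw [hLa, inner_wigner hf' hfc' hg, pairingTrace]
    congr 1
    refine integral_congr_ae (Filter.Eventually.of_forall fun y => ?_)
    simp only [coeffK]
    ring

lemma eq_pairingTrace (huw : ∀ r, KPowGraph r 1 (u r) (w r)) {f g : PAff → ℂ}
    (hf : Continuous f) (hfc : HasCompactSupport f) (hg : Continuous g) {x : PAff} {r : PDual}
    {z : ℂ} (h : ∃ T : HCone r →L[ℂ] HCone r,
      ExtendsMulK r 1 (fun φ => star (rankOneSymbol H u v x r) (wigner f g x r φ)) T ∧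
      HasTrace T z) : z = pairingTrace H w v f g x r := by
  obtain ⟨T, hT, hz⟩ := h
  obtain ⟨S, hS, hS'⟩ := exists_trace_rankOneSymbol (H := H) (v := v) huw hf hfc hg x r
  have : T = S := eq_of_eq_on_domain fun φ ψ hφ => (hT φ ψ hφ).trans (hS φ ψ hφ).symm
  subst this
  exact hz.unique hS'

lemma continuous_conv {F g : PAff → ℂ} (hF : Continuous F) (hFc : HasCompactSupport F)
    (hg : Continuous g) : Continuous fun x => ∫ y, F y * g (y⁻¹ * x) ∂PAff.haar := by
  rw [← continuousOn_univ]
  refine continuousOn_integral_of_compact_support (k := tsupport F) hFc ?_ ?_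
  · refine Continuous.continuousOn ?_
    have h1 : Continuous fun q : PAff × PAff => g (q.2⁻¹ * q.1) := hg.comp (by fun_prop)
    have h2 : Continuous fun q : PAff × PAff => F q.2 := hF.comp continuous_snd
    exact h2.mul h1
  · intro x y _ hy
    rw [image_eq_zero_of_notMem_tsupport hy, zero_mul]

open scoped Pointwise in
lemma hasCompactSupport_conv {F g : PAff → ℂ} (hFc : HasCompactSupport F)
    (hgc : HasCompactSupport g) :
    HasCompactSupport fun x => ∫ y, F y * g (y⁻¹ * x) ∂PAff.haar := by
  refine HasCompactSupport.intro (K := tsupport F * tsupport g) (hFc.mul hgc) fun x hx => ?_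
  have : ∀ y, F y * g (y⁻¹ * x) = 0 := by
    intro y
    by_contra h
    refine hx ⟨y, subset_tsupport F (left_ne_zero_of_mul h), y⁻¹ * x,
      subset_tsupport g (right_ne_zero_of_mul h), by simp⟩
  simp [this]

lemma integrable_pairingTrace (hHm : ∀ r, Measurable fun x => H x r) (hHb : ∀ x r, |H x r| ≤ 1)
    {f g : PAff → ℂ} (hf : Continuous f) (hfc : HasCompactSupport f) (hg : Continuous g)
    (hgc : HasCompactSupport g) (r : PDual) :
    Integrable (fun x => pairingTrace H w v f g x r) PAff.haar := by
  have hF : Continuous fun y => f y * coeffK r (w r) (v r) y := hf.mul (continuous_coeffK _ _ _)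
  have hFc : HasCompactSupport fun y => f y * coeffK r (w r) (v r) y := hfc.mul_right
  have h := (continuous_conv hF hFc hg).integrable_of_hasCompactSupport (μ := PAff.haar)
    (hasCompactSupport_conv hFc hgc)
  refine h.mono ?_ ?_
  · exact (Complex.measurable_ofReal.comp (hHm r)).aestronglyMeasurable.mul h.1
  · refine Filter.Eventually.of_forall fun x => ?_
    rw [pairingTrace, norm_mul, Complex.norm_real]
    exact mul_le_of_le_one_left (norm_nonneg _) (hHb x r)

/-- One direction shows that the Weyl transform is defined; the other computes the pairing
attributed to a hypothetical bounded operator. -/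
lemma hasPairing_rankOneSymbol_iff (huw : ∀ r, KPowGraph r 1 (u r) (w r))
    (hHm : ∀ r, Measurable fun x => H x r) (hHb : ∀ x r, |H x r| ≤ 1)
    {f g : PAff → ℂ} (hf : Continuous f) (hfc : HasCompactSupport f) (hg : Continuous g)
    (hgc : HasCompactSupport g) (z : ℂ) :
    HasPairing f g (rankOneSymbol H u v) z ↔
      z = ∑ r : PDual, ∫ x, pairingTrace H w v f g x r ∂PAff.haar := by
  constructor
  · rintro ⟨t, ht, -, rfl⟩
    refine Finset.sum_congr rfl fun r _ => integral_congr_ae ?_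
    filter_upwards [ht r] with x hx
    exact eq_pairingTrace huw hf hfc hg hx
  · intro hz
    exact ⟨pairingTrace H w v f g, fun r => Filter.Eventually.of_forall fun x =>
      exists_trace_rankOneSymbol huw hf hfc hg x r,
      integrable_pairingTrace hHm hHb hf hfc hg hgc, hz⟩

end Pairing

/-- Because `K^{1/p}` is symmetric, `|Hu⟩⟨v| K^{1/p}` extends to `|Hu⟩⟨K^{1/p} v|`, so only the
scalar `L^p` norm of `H` remains. -/
lemma memLpSymbol_rankOneSymbol {p : ℝ} (hp : 0 < p) {H : PAff → PDual → ℝ}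
    {u v v' : (r : PDual) → HCone r} (hv : ∀ r, KPowGraph r (1 / p) (v r) (v' r))
    (hHm : ∀ r, Measurable fun x => H x r)
    (hHp : ∀ r, ∫⁻ x, ENNReal.ofReal (|H x r| ^ p) ∂PAff.haar < ∞) :
    MemLpSymbol p (rankOneSymbol H u v) where
  measurable r φ ψ := by
    simp only [rankOneSymbol, InnerProductSpace.rankOne_apply, inner_smul_right]
    exact ((Complex.measurable_ofReal.comp (hHm r)).mul_const _).const_mul _
  schatten x r := (schattenPow_rankOne_le hp _ _).trans_lt ENNReal.ofReal_lt_top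
  norm_lt_top := by
    refine ENNReal.sum_lt_top.2 fun r _ => ?_
    have hle : ∀ x, schattenPowMulK r p (1 / p) (rankOneSymbol H u v x r) ≤
        ENNReal.ofReal (|H x r| ^ p) * ENNReal.ofReal ((‖u r‖ * ‖v' r‖) ^ p) := by
      intro x
      have hext : ExtendsMulK r (1 / p) (rankOneSymbol H u v x r)
          (InnerProductSpace.rankOne ℂ ((H x r : ℂ) • u r) (v' r)) := by
        intro φ ψ hφ
        rw [rankOneSymbol, InnerProductSpace.rankOne_apply, InnerProductSpace.rankOne_apply,
          hφ.inner_eq (hv r)]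
      refine (iInf₂_le _ hext).trans ((schattenPow_rankOne_le hp _ _).trans (le_of_eq ?_))
      rw [norm_smul, Complex.norm_real, Real.norm_eq_abs, mul_assoc,
        Real.mul_rpow (abs_nonneg _) (by positivity), ENNReal.ofReal_mul (by positivity)]
    refine (lintegral_mono hle).trans_lt ?_
    rw [lintegral_mul_const' _ _ ENNReal.ofReal_ne_top]
    exact ENNReal.mul_lt_top (hHp r) ENNReal.ofReal_lt_top

/-! ### A family of vectors in the domains of the powers of `K` -/

lemma memLp_indicator_kfun (r : PDual) (s : NNReal) :
    MemLp ((Metric.closedBall (0 : ℝ × ℝ) 2).indicator fun x => ((kfun x ^ (s : ℝ) : ℝ) : ℂ)) 2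
      ((volume : Measure (ℝ × ℝ)).restrict (cone r)) := by
  -- Non-negativity of `s` keeps the power continuous on the light cone, where `kfun` vanishes.
  have hc : Continuous fun x => ((kfun x ^ (s : ℝ) : ℝ) : ℂ) :=
    Complex.continuous_ofReal.comp (continuous_kfun.rpow_const fun x => Or.inr s.2)
  rw [memLp_indicator_iff_restrict Metric.isClosed_closedBall.measurableSet]
  obtain ⟨C, hC⟩ := (isCompact_closedBall (0 : ℝ × ℝ) 2).exists_bound_of_continuousOn
    hc.continuousOn
  have : IsFiniteMeasure (((volume : Measure (ℝ × ℝ)).restrict (cone r)).restrict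
      (Metric.closedBall (0 : ℝ × ℝ) 2)) :=
    isFiniteMeasure_restrict.2 (isCompact_closedBall (0 : ℝ × ℝ) 2).measure_lt_top.ne
  refine MemLp.of_bound hc.aestronglyMeasurable C ?_
  exact (ae_restrict_mem Metric.isClosed_closedBall.measurableSet).mono hC

/-- The function `K^s` on the ball of radius `2`. -/
def kVec (s : NNReal) (r : PDual) : HCone r := (memLp_indicator_kfun r s).toLp _

lemma kPowGraph_kVec (s : NNReal) (r : PDual) : KPowGraph r s (kVec 0 r) (kVec s r) := by
  filter_upwards [(memLp_indicator_kfun r 0).coeFn_toLp, (memLp_indicator_kfun r s).coeFn_toLp]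
    with x h1 h2
  rw [kVec, kVec, h1, h2, ← kfun]
  by_cases hx : x ∈ Metric.closedBall (0 : ℝ × ℝ) 2 <;> simp [hx]

lemma rep_one (r : PDual) (φ : HCone r) : rep r 1 φ = φ := by
  refine Lp.ext ?_
  filter_upwards [coe_rep r 1 φ] with x h1
  simp [h1, repFun, dilRot, PAff.one_a, PAff.one_b, PAff.one_th, hypRot_zero, mink]

/-- The cone meets the open ball in a non-empty open set, around `(1, 0)`, on which `kfun` is
positive. -/
lemma kVec_half_ne_zero : kVec (1 / 2) (0, 0) ≠ 0 := by
  intro h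
  replace h := (memLp_indicator_kfun (0, 0) (1 / 2)).coeFn_toLp.symm.trans
    ((Lp.eq_zero_iff_ae_eq_zero).1 h)
  have hopen : IsOpen (cone (0, 0)) := by
    have h1 : IsOpen {x : ℝ × ℝ | x.2 ^ 2 < x.1 ^ 2} := isOpen_lt (by fun_prop) (by fun_prop)
    have h2 : IsOpen {x : ℝ × ℝ | 0 < sgn 0 * x.1} := isOpen_lt (by fun_prop) (by fun_prop)
    simp only [cone, if_true]
    exact h1.inter h2
  rw [Filter.EventuallyEq, ae_restrict_iff' (measurableSet_cone _)] at h
  have hpos : 0 < volume (cone (0, 0) ∩ Metric.ball (0 : ℝ × ℝ) 2) := by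
    refine (hopen.inter Metric.isOpen_ball).measure_pos _ ⟨(1, 0), ?_, ?_⟩
    · simp [cone, sgn]
    · simp [Prod.norm_def]
  refine hpos.ne' (measure_mono_null (fun x hx => ?_) h)
  simp only [Set.mem_compl_iff, Set.mem_ofPred_eq, not_forall]
  refine ⟨hx.1, ?_⟩
  rw [Set.indicator_of_mem (Metric.ball_subset_closedBall hx.2)]
  have hk : 0 < kfun x := by
    have : x.2 ^ 2 < x.1 ^ 2 := by
      have := hx.1
      simp only [cone, if_true] at this
      exact this.1
    refine mul_pos (by positivity) (abs_pos.2 ?_)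
    simp only [mink]
    nlinarith
  have := Real.rpow_pos_of_pos hk ((1 / 2 : NNReal) : ℝ)
  simp only [Pi.zero_apply]
  exact_mod_cast this.ne'

/-- At the identity the coefficient is `⟪K u, u⟫ = ‖K^{1/2} u‖²` with `u = kVec 0`. -/
lemma coeffK_kVec_one : 0 < (coeffK (0, 0) (kVec 1 (0, 0)) (kVec 0 (0, 0)) 1).re := by
  have h : ⟪kVec 1 (0, 0), kVec 0 (0, 0)⟫_ℂ = ⟪kVec (1 / 2) (0, 0), kVec (1 / 2) (0, 0)⟫_ℂ := by
    rw [L2.inner_def, L2.inner_def]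
    refine integral_congr_ae ?_
    filter_upwards [(memLp_indicator_kfun (0, 0) 0).coeFn_toLp,
      (memLp_indicator_kfun (0, 0) 1).coeFn_toLp,
      (memLp_indicator_kfun (0, 0) (1 / 2)).coeFn_toLp] with x h1 h2 h3
    rw [kVec, kVec, kVec, h1, h2, h3]
    by_cases hx : x ∈ Metric.closedBall (0 : ℝ × ℝ) 2
    · have hs : kfun x = kfun x ^ ((1 / 2 : NNReal) : ℝ) * kfun x ^ ((1 / 2 : NNReal) : ℝ) := by
        rw [← Real.rpow_add_of_nonneg (kfun_nonneg x) (by simp) (by simp)]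
        norm_num
      simp only [hx, Set.indicator_of_mem, RCLike.inner_apply, Complex.conj_ofReal,
        NNReal.coe_zero, NNReal.coe_one, Real.rpow_zero, Real.rpow_one, Complex.ofReal_one,
        one_mul]
      rw [← Complex.ofReal_mul, ← hs]
    · simp [hx]
  rw [coeffK, rep_one, h, inner_self_eq_norm_sq_to_K, PAff.one_a]
  have : 0 < ‖kVec (1 / 2) (0, 0)‖ ^ 2 := by
    have := norm_pos_iff.2 kVec_half_ne_zero
    positivity
  simpa [← Complex.ofReal_pow] using this

/-! ### Integration of products on the group -/

namespace PAff

instance : dilMeasure.IsOpenPosMeasure where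
  open_pos U hU hne := by
    rw [dilMeasure, (MeasurableEmbedding.subtype_coe measurableSet_Ioi).comap_apply]
    exact ((isOpen_Ioi.isOpenMap_subtype_val U hU).measure_pos _ (hne.image _)).ne'

/-- The measure `db da / a³` on `ℝ² × (0, ∞)`. -/
def transDilMeasure : Measure ((ℝ × ℝ) × Set.Ioi (0 : ℝ)) :=
  ((volume : Measure (ℝ × ℝ)).prod dilMeasure).withDensity
    fun q => ENNReal.ofReal (((q.2 : ℝ) ^ 3)⁻¹)

lemma continuous_density :
    Continuous fun q : (ℝ × ℝ) × Set.Ioi (0 : ℝ) => ((q.2 : ℝ) ^ 3)⁻¹ :=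
  Continuous.inv₀ (by fun_prop) fun q => (pow_pos q.2.2 3).ne'

instance : IsLocallyFiniteMeasure transDilMeasure :=
  IsLocallyFiniteMeasure.withDensity_ofReal continuous_density

instance : transDilMeasure.IsOpenPosMeasure := by
  refine Measure.AbsolutelyContinuous.isOpenPosMeasure
    (μ := (volume : Measure (ℝ × ℝ)).prod dilMeasure) ?_
  refine withDensity_absolutelyContinuous' ?_ (Filter.Eventually.of_forall fun q => ?_)
  · exact continuous_density.measurable.ennreal_ofReal.aemeasurable
  · simpa using pow_pos q.2.2 3

instance : haar.IsOpenPosMeasure := by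
  have : lebesgue.IsOpenPosMeasure := inferInstanceAs
    (((volume : Measure (ℝ × ℝ)).prod (dilMeasure.prod (volume : Measure ℝ))).IsOpenPosMeasure)
  refine Measure.AbsolutelyContinuous.isOpenPosMeasure (μ := lebesgue) ?_
  refine withDensity_absolutelyContinuous' ?_ (Filter.Eventually.of_forall fun q => ?_)
  · exact ((continuous_a.pow 3).inv₀
      fun g => (pow_pos g.a_pos 3).ne').measurable.ennreal_ofReal.aemeasurable
  · simpa using pow_pos q.a_pos 3

/-- The translation and dilation part. -/
def transDil (g : PAff) : (ℝ × ℝ) × Set.Ioi (0 : ℝ) := (g.1, g.2.1)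

@[fun_prop]
lemma continuous_transDil : Continuous transDil :=
  (continuous_fst.prodMk (continuous_fst.comp continuous_snd) :
    Continuous (fun g : (ℝ × ℝ) × Set.Ioi (0 : ℝ) × ℝ => (g.1, g.2.1)))

/-- The Haar density depends on `a` alone, so the angle splits off as a Lebesgue factor. -/
lemma lintegral_haar_mul {F : (ℝ × ℝ) × Set.Ioi (0 : ℝ) → ℝ≥0∞} {G : ℝ → ℝ≥0∞}
    (hF : Measurable F) (hG : Measurable G) :
    ∫⁻ g, F g.transDil * G g.th ∂haar = (∫⁻ q, F q ∂transDilMeasure) * ∫⁻ t, G t := by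
  have hd : Measurable fun g : PAff => ENNReal.ofReal ((g.a ^ 3)⁻¹) :=
    ((continuous_a.pow 3).inv₀ fun g => (pow_pos g.a_pos 3).ne').measurable.ennreal_ofReal
  have hFG : Measurable fun g : PAff => F g.transDil * G g.th :=
    (hF.comp continuous_transDil.measurable).mul (hG.comp continuous_th.measurable)
  rw [haar, lintegral_withDensity_eq_lintegral_mul _ hd hFG, transDilMeasure,
    lintegral_withDensity_eq_lintegral_mul _ continuous_density.measurable.ennreal_ofReal hF]
  have hmF : Measurable ((fun q : (ℝ × ℝ) × Set.Ioi (0 : ℝ) =>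
      ENNReal.ofReal (((q.2 : ℝ) ^ 3)⁻¹)) * F) :=
    continuous_density.measurable.ennreal_ofReal.mul hF
  refine (lintegral_prod (μ := (volume : Measure (ℝ × ℝ)))
    (ν := dilMeasure.prod (volume : Measure ℝ)) _ (hd.mul hFG).aemeasurable).trans ?_
  rw [lintegral_prod _ hmF.aemeasurable, ← lintegral_mul_const _ hmF.lintegral_prod_right']
  refine lintegral_congr fun b => ?_
  have hs : Measurable fun q : Set.Ioi (0 : ℝ) × ℝ =>
      ((fun q : (ℝ × ℝ) × Set.Ioi (0 : ℝ) => ENNReal.ofReal (((q.2 : ℝ) ^ 3)⁻¹)) * F) (b, q.1)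
        * G q.2 :=
    (hmF.comp (measurable_const.prodMk measurable_fst)).mul (hG.comp measurable_snd)
  have hb : Measurable fun a : Set.Ioi (0 : ℝ) =>
      ((fun q : (ℝ × ℝ) × Set.Ioi (0 : ℝ) => ENNReal.ofReal (((q.2 : ℝ) ^ 3)⁻¹)) * F) (b, a) :=
    hmF.comp (measurable_const.prodMk measurable_id)
  refine Eq.trans ?_ (((lintegral_prod (μ := dilMeasure) (ν := (volume : Measure ℝ)) _
    hs.aemeasurable).trans ?_).trans (lintegral_mul_const _ hb))
  · refine lintegral_congr fun q => ?_
    exact (mul_assoc _ _ _).symm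
  · refine lintegral_congr fun a => ?_
    dsimp only
    exact lintegral_const_mul (μ := (volume : Measure ℝ)) _ hG

end PAff

/-! ### The weight in the hyperbolic angle -/

/-- The function `(1 + |t|)^{-1/2}`. -/
def angleWeight (t : ℝ) : ℝ := (Real.sqrt (1 + |t|))⁻¹

lemma angleWeight_pos (t : ℝ) : 0 < angleWeight t := by
  unfold angleWeight
  positivity

lemma angleWeight_le_one (t : ℝ) : angleWeight t ≤ 1 :=
  inv_le_one_of_one_le₀ (Real.one_le_sqrt.2 (by linarith [abs_nonneg t]))

lemma angleWeight_sq (t : ℝ) : angleWeight t ^ 2 = (1 + |t|)⁻¹ := by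
  rw [angleWeight, inv_pow, Real.sq_sqrt (by positivity)]

lemma continuous_one_add_abs_inv : Continuous fun t : ℝ => (1 + |t|)⁻¹ :=
  Continuous.inv₀ (by fun_prop) fun t => by positivity

lemma continuous_angleWeight : Continuous angleWeight :=
  Continuous.inv₀ (by fun_prop) fun t => by positivity

/-- The weight is slowly varying: `1 + |t - s| ≤ 2 + |t| ≤ 2 (1 + |t|)`. -/
lemma angleWeight_le_mul (s t : ℝ) (hs : |s| ≤ 1) :
    angleWeight t ≤ Real.sqrt 2 * angleWeight (-s + t) := by
  unfold angleWeight
  rw [← div_eq_mul_inv, inv_eq_one_div, div_le_div_iff₀ (by positivity) (by positivity), one_mul,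
    ← Real.sqrt_mul (by norm_num)]
  refine Real.sqrt_le_sqrt ?_
  have := abs_add_le (-s) t
  rw [abs_neg] at this
  linarith [abs_nonneg t]

/-- The integrand is `(1 + |t|)^{-p/2}`, and `p / 2 > 1` is exactly the integrability condition;
here `p > 2` is essential. -/
lemma lintegral_angleWeight_rpow_lt_top {p : ℝ} (hp : 2 < p) :
    ∫⁻ t, ENNReal.ofReal (angleWeight t ^ p) < ∞ := by
  have h := integrable_one_add_norm (E := ℝ) (μ := volume) (r := p / 2) (by simp; linarith)
  refine lt_of_le_of_lt (le_of_eq (lintegral_congr fun t => ?_)) h.lintegral_lt_top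
  congr 1
  rw [angleWeight, Real.sqrt_eq_rpow, ← Real.rpow_neg (by positivity),
    ← Real.rpow_mul (by positivity), Real.norm_eq_abs]
  congr 1
  ring

/-- The integral of `1 / (1 + |t|)` over `[-N, N]`. -/
def angleMass (N : ℝ) : ℝ := ∫ t in (-N)..N, (1 + |t|)⁻¹

lemma log_le_angleMass {N : ℝ} (hN : 0 ≤ N) : Real.log (1 + N) ≤ angleMass N := by
  have hi := fun a b => continuous_one_add_abs_inv.intervalIntegrable (μ := volume) a b
  have h1 : ∫ t in (0 : ℝ)..N, (1 + |t|)⁻¹ = Real.log (1 + N) := by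
    have : ∫ t in (0 : ℝ)..N, (1 + |t|)⁻¹ = ∫ t in (0 : ℝ)..N, (1 + t)⁻¹ := by
      refine intervalIntegral.integral_congr fun t ht => ?_
      rw [Set.uIcc_of_le hN] at ht
      simp only [abs_of_nonneg ht.1]
    rw [this, intervalIntegral.integral_comp_add_left (fun t => t⁻¹),
      integral_inv_of_pos (by linarith) (by linarith)]
    simp
  rw [angleMass, ← intervalIntegral.integral_add_adjacent_intervals (hi (-N) 0) (hi 0 N), h1]
  have : 0 ≤ ∫ t in (-N)..0, (1 + |t|)⁻¹ :=
    intervalIntegral.integral_nonneg (by linarith) fun t _ => by positivity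
  linarith

/-- The two added intervals have length 2 and the integrand is at most 1. This makes the cost of the
cutoff harmless. -/
lemma angleMass_add_two_le (N : ℝ) : angleMass (N + 2) ≤ angleMass N + 4 := by
  have hi := fun a b => continuous_one_add_abs_inv.intervalIntegrable (μ := volume) a b
  have hle : ∀ a : ℝ, ∫ t in a..(a + 2), (1 + |t|)⁻¹ ≤ 2 := by
    intro a
    have h := intervalIntegral.integral_mono_on (by linarith : a ≤ a + 2) (hi a (a + 2))
      (intervalIntegrable_const (c := (1 : ℝ)) (μ := volume))
      (fun t _ => inv_le_one_of_one_le₀ (by linarith [abs_nonneg t]))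
    refine h.trans (le_of_eq ?_)
    simp
  have h1 := hle (-(N + 2))
  have h2 := hle N
  rw [show -(N + 2) + 2 = -N by ring] at h1
  rw [angleMass, angleMass,
    ← intervalIntegral.integral_add_adjacent_intervals (hi (-(N + 2)) (-N)) (hi (-N) (N + 2)),
    ← intervalIntegral.integral_add_adjacent_intervals (hi (-N) N) (hi N (N + 2))]
  linarith

lemma lintegral_indicator_Icc_angle {N : ℝ} (hN : 0 ≤ N) :
    ∫⁻ t, (Set.Icc (-N) N).indicator (fun t => ENNReal.ofReal ((1 + |t|)⁻¹)) t =
      ENNReal.ofReal (angleMass N) := by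
  rw [lintegral_indicator measurableSet_Icc, angleMass,
    intervalIntegral.integral_of_le (by linarith), ← integral_Icc_eq_integral_Ioc,
    ofReal_integral_eq_lintegral_ofReal]
  · exact continuous_one_add_abs_inv.continuousOn.integrableOn_Icc
  · exact Filter.Eventually.of_forall fun t => by positivity

/-- A continuous cutoff function, equal to one on `[-N-1, N+1]` and zero off `[-N-2, N+2]`. -/
def angleCutoff (N t : ℝ) : ℝ := max 0 (min 1 (N + 2 - |t|))

lemma continuous_angleCutoff (N : ℝ) : Continuous (angleCutoff N) := by
  unfold angleCutoff
  fun_prop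

lemma angleCutoff_nonneg (N t : ℝ) : 0 ≤ angleCutoff N t := le_max_left _ _

lemma angleCutoff_le_one (N t : ℝ) : angleCutoff N t ≤ 1 :=
  max_le zero_le_one (min_le_left _ _)

lemma angleCutoff_eq_one {N t : ℝ} (h : |t| ≤ N + 1) : angleCutoff N t = 1 := by
  rw [angleCutoff, min_eq_left (by linarith), max_eq_right zero_le_one]

lemma angleCutoff_eq_zero {N t : ℝ} (h : t ∉ Set.Icc (-(N + 2)) (N + 2)) :
    angleCutoff N t = 0 := by
  rw [Set.mem_Icc, ← abs_le, not_le] at h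
  exact max_eq_left ((min_le_right _ _).trans (by linarith))

/-! ### The symbol -/

/-- The symbol function: the indicator of a set in translation and dilation times a power of the
hyperbolic angle, on the first representation only. -/
def symbolWeight (B : Set ((ℝ × ℝ) × Set.Ioi (0 : ℝ))) (x : PAff) (r : PDual) : ℝ :=
  if r = (0, 0) then B.indicator 1 x.transDil * angleWeight x.th else 0

section Weight

variable {B : Set ((ℝ × ℝ) × Set.Ioi (0 : ℝ))}

lemma symbolWeight_nonneg (x : PAff) (r : PDual) : 0 ≤ symbolWeight B x r := by
  unfold symbolWeight
  split_ifs
  · exact mul_nonneg (Set.indicator_nonneg (by simp) _) (angleWeight_pos _).le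
  · exact le_rfl

lemma abs_symbolWeight_le_one (x : PAff) (r : PDual) : |symbolWeight B x r| ≤ 1 := by
  rw [abs_of_nonneg (symbolWeight_nonneg x r)]
  unfold symbolWeight
  split_ifs
  · exact mul_le_one₀ (Set.indicator_le_self' (by simp) _) (angleWeight_pos _).le
      (angleWeight_le_one _)
  · exact zero_le_one

lemma measurable_symbolWeight (hB : MeasurableSet B) (r : PDual) :
    Measurable fun x => symbolWeight B x r := by
  unfold symbolWeight
  split_ifs
  · exact ((measurable_one.indicator hB).comp PAff.continuous_transDil.measurable).mul
      (continuous_angleWeight.measurable.comp PAff.continuous_th.measurable)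
  · exact measurable_const

lemma lintegral_symbolWeight_lt_top (hB : IsCompact B) {p : ℝ} (hp : 2 < p) (r : PDual) :
    ∫⁻ x, ENNReal.ofReal (|symbolWeight B x r| ^ p) ∂PAff.haar < ∞ := by
  have hle : ∀ x, ENNReal.ofReal (|symbolWeight B x r| ^ p) ≤
      B.indicator 1 x.transDil * ENNReal.ofReal (angleWeight x.th ^ p) := by
    intro x
    unfold symbolWeight
    split_ifs
    · by_cases hx : x.transDil ∈ B
      · simp [hx, abs_of_pos (angleWeight_pos _)]
      · simp [hx, (by linarith : p ≠ 0)]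
    · simp [(by linarith : p ≠ 0)]
  refine (lintegral_mono hle).trans_lt ?_
  have hG : Measurable fun t => ENNReal.ofReal (angleWeight t ^ p) :=
    (continuous_angleWeight.measurable.pow_const p).ennreal_ofReal
  rw [PAff.lintegral_haar_mul (measurable_one.indicator hB.measurableSet) hG]
  refine ENNReal.mul_lt_top ?_ (lintegral_angleWeight_rpow_lt_top hp)
  rw [lintegral_indicator_one hB.measurableSet]
  exact hB.measure_lt_top

end Weight

/-! ### Unboundedness -/

/-- The real part of the matrix coefficient of the first representation. -/
def coeffRe (y : PAff) : ℝ := (coeffK (0, 0) (kVec 1 (0, 0)) (kVec 0 (0, 0)) y).re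

lemma continuous_coeffRe : Continuous coeffRe :=
  Complex.continuous_re.comp (continuous_coeffK _ _ _)

/-- `coeffRe` is continuous and positive at the identity, so a Urysohn function supported close to
it works. -/
lemma exists_bump : ∃ (V : Set PAff) (f : PAff → ℝ), IsCompact V ∧ (∀ y ∈ V, |y.th| ≤ 1) ∧
    Continuous f ∧ HasCompactSupport f ∧ (∀ y, y ∉ V → f y = 0) ∧ (∀ y, 0 ≤ f y * coeffRe y) ∧
    0 < ∫ y, f y * coeffRe y ∂PAff.haar := by
  have hU : IsOpen {y : PAff | 0 < coeffRe y ∧ |y.th| < 1} :=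
    (isOpen_lt continuous_const continuous_coeffRe).inter
      (isOpen_lt (by fun_prop : Continuous fun y : PAff => |y.th|) continuous_const)
  obtain ⟨V, hV, h1, hVU⟩ := exists_compact_subset hU (x := 1)
    ⟨coeffK_kVec_one, by simp [PAff.one_th]⟩
  obtain ⟨f, hf1, hf0, hfc, hf⟩ := exists_continuous_one_zero_of_isCompact
    (isCompact_singleton (x := (1 : PAff))) isOpen_interior.isClosed_compl
    (Set.disjoint_singleton_left.2 (by simpa using h1))
  have hzero : ∀ y, y ∉ V → f y = 0 := fun y hy => hf0 fun h => hy (interior_subset h)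
  have hnn : ∀ y, 0 ≤ f y * coeffRe y := by
    intro y
    by_cases hy : y ∈ V
    · exact mul_nonneg (hf y).1 (hVU hy).1.le
    · simp [hzero y hy]
  refine ⟨V, f, hV, fun y hy => (hVU hy).2.le, f.continuous, hfc, hzero, hnn, ?_⟩
  refine (f.continuous.mul continuous_coeffRe).integral_pos_of_hasCompactSupport_nonneg_nonzero
    hfc.mul_right (x := 1) hnn ?_
  rw [hf1 rfl, Pi.one_apply, one_mul]
  exact coeffK_kVec_one.ne'

/-- A product of a function of translation and dilation with a truncated weight in the angle. -/
def testFun (β : (ℝ × ℝ) × Set.Ioi (0 : ℝ) → ℝ) (N : ℝ) (x : PAff) : ℝ :=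
  β x.transDil * (angleWeight x.th * angleCutoff N x.th)

/-! ### The `L²` norm of the test functions. -/

section TestFun

variable {β : (ℝ × ℝ) × Set.Ioi (0 : ℝ) → ℝ}

lemma continuous_testFun (hβ : Continuous β) (N : ℝ) : Continuous (testFun β N) :=
  (hβ.comp PAff.continuous_transDil).mul
    ((continuous_angleWeight.comp PAff.continuous_th).mul
      ((continuous_angleCutoff N).comp PAff.continuous_th))

lemma hasCompactSupport_testFun (hβc : HasCompactSupport β) (N : ℝ) :
    HasCompactSupport (testFun β N) := by
  have he : Continuous fun q : ((ℝ × ℝ) × Set.Ioi (0 : ℝ)) × ℝ =>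
      PAff.mk q.1.1 q.1.2 q.1.2.2 q.2 :=
    PAff.continuous_of_coords (by change Continuous fun q : ((ℝ × ℝ) × Set.Ioi (0 : ℝ)) × ℝ => q.1.1; fun_prop)
      (by change Continuous fun q : ((ℝ × ℝ) × Set.Ioi (0 : ℝ)) × ℝ => (q.1.2 : ℝ); fun_prop)
      (by change Continuous fun q : ((ℝ × ℝ) × Set.Ioi (0 : ℝ)) × ℝ => q.2; fun_prop)
  refine HasCompactSupport.intro
    (((IsCompact.prod hβc (isCompact_Icc (a := -(N + 2)) (b := N + 2))).image he)) fun x hx => ?_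
  by_contra h
  refine hx ⟨(x.transDil, x.th), ⟨subset_tsupport β (left_ne_zero_of_mul h), ?_⟩, rfl⟩
  by_contra ht
  exact right_ne_zero_of_mul (right_ne_zero_of_mul h) (angleCutoff_eq_zero ht)

lemma lintegral_testFun_sq_le (hβ : Continuous β) {N : ℝ} (hN : 0 ≤ N) :
    ∫⁻ x, ENNReal.ofReal (testFun β N x ^ 2) ∂PAff.haar ≤
      (∫⁻ q, ENNReal.ofReal (β q ^ 2) ∂PAff.transDilMeasure) *
        ENNReal.ofReal (angleMass (N + 2)) := by
  have hF : Measurable fun q => ENNReal.ofReal (β q ^ 2) := (hβ.pow 2).measurable.ennreal_ofReal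
  rw [← lintegral_indicator_Icc_angle (by linarith), ← PAff.lintegral_haar_mul hF
    (continuous_one_add_abs_inv.measurable.ennreal_ofReal.indicator measurableSet_Icc)]
  refine lintegral_mono fun x => ?_
  rw [testFun, mul_pow, ENNReal.ofReal_mul (by positivity)]
  gcongr
  by_cases ht : x.th ∈ Set.Icc (-(N + 2)) (N + 2)
  · rw [Set.indicator_of_mem ht, mul_pow, angleWeight_sq]
    exact ENNReal.ofReal_le_ofReal (mul_le_of_le_one_right (by positivity)
      (pow_le_one₀ (angleCutoff_nonneg _ _) (angleCutoff_le_one _ _)))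
  · simp [angleCutoff_eq_zero ht]

/-- The constant is `∫ β²`, independent of `N`; all growth sits in the angular factor. -/
lemma norm_ccToL2_testFun_sq_le (hβ : Continuous β) (hβc : HasCompactSupport β) :
    ∃ C : ℝ, 0 ≤ C ∧ ∀ N : ℝ, 0 ≤ N →
      ∀ (h : Continuous fun x => (testFun β N x : ℂ))
        (h' : HasCompactSupport fun x => (testFun β N x : ℂ)),
        ‖ccToL2 (fun x => (testFun β N x : ℂ)) h h'‖ ^ 2 ≤ C * angleMass (N + 2) := by
  have hfin : ∫⁻ q, ENNReal.ofReal (β q ^ 2) ∂PAff.transDilMeasure < ∞ := by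
    have hc : HasCompactSupport fun q => β q ^ 2 := hβc.comp_left (g := fun t => t ^ 2) (by simp)
    exact ((hβ.pow 2).integrable_of_hasCompactSupport hc).lintegral_lt_top
  refine ⟨(∫⁻ q, ENNReal.ofReal (β q ^ 2) ∂PAff.transDilMeasure).toReal, ENNReal.toReal_nonneg,
    fun N hN h h' => ?_⟩
  have hJ : 0 ≤ angleMass (N + 2) :=
    (Real.log_nonneg (by linarith)).trans (log_le_angleMass (by linarith))
  have hint : ‖ccToL2 (fun x => (testFun β N x : ℂ)) h h'‖ ^ 2 =
      ∫ x, testFun β N x ^ 2 ∂PAff.haar := by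
    rw [norm_sq_eq_integral]
    refine integral_congr_ae ?_
    filter_upwards [(h.memLp_of_hasCompactSupport (p := 2) (μ := PAff.haar) h').coeFn_toLp]
      with x hx
    rw [ccToL2, hx, Complex.norm_real, Real.norm_eq_abs, sq_abs]
  rw [hint, integral_eq_lintegral_of_nonneg_ae (Filter.Eventually.of_forall fun x => sq_nonneg _)
    ((continuous_testFun hβ N).pow 2).aestronglyMeasurable, ← ENNReal.toReal_ofReal hJ,
    ← ENNReal.toReal_mul]
  exact ENNReal.toReal_mono (ENNReal.mul_lt_top hfin ENNReal.ofReal_lt_top).ne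
    (lintegral_testFun_sq_le hβ hN)

end TestFun

/-- The translation and dilation parts of `y⁻¹x` do not involve the angle of `x`, so they fill a
compact set although `x` ranges over an unbounded one. -/
lemma exists_test_profile {B : Set ((ℝ × ℝ) × Set.Ioi (0 : ℝ))} (hB : IsCompact B)
    {V : Set PAff} (hV : IsCompact V) :
    ∃ β : (ℝ × ℝ) × Set.Ioi (0 : ℝ) → ℝ, Continuous β ∧ HasCompactSupport β ∧ (∀ q, 0 ≤ β q) ∧
      ∀ y ∈ V, ∀ x : PAff, x.transDil ∈ B → β (y⁻¹ * x).transDil = 1 := by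
  have he : Continuous fun q : (ℝ × ℝ) × Set.Ioi (0 : ℝ) => PAff.mk q.1 q.2 q.2.2 0 :=
    PAff.continuous_of_coords (by change Continuous fun q : (ℝ × ℝ) × Set.Ioi (0 : ℝ) => q.1; fun_prop)
      (by change Continuous fun q : (ℝ × ℝ) × Set.Ioi (0 : ℝ) => (q.2 : ℝ); fun_prop)
      (by change Continuous fun _ => (0 : ℝ); fun_prop)
  have hc : Continuous fun z : PAff × ((ℝ × ℝ) × Set.Ioi (0 : ℝ)) =>
      (z.1⁻¹ * PAff.mk z.2.1 z.2.2 z.2.2.2 0).transDil :=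
    PAff.continuous_transDil.comp (continuous_fst.inv.mul (he.comp continuous_snd))
  obtain ⟨β, h1, -, hβc, hβ⟩ := exists_continuous_one_zero_of_isCompact
    ((hV.prod hB).image hc) isClosed_empty (Set.disjoint_empty _)
  exact ⟨β, β.continuous, hβc, fun q => (hβ q).1, fun y hy x hx =>
    h1 ⟨(y, x.transDil), ⟨hy, hx⟩, rfl⟩⟩

/-- With `f`, `g` and the weight real, taking real parts only replaces the coefficient by `coeffRe`;
the other three representations contribute zero. -/
lemma re_sum_integral_pairingTrace {B : Set ((ℝ × ℝ) × Set.Ioi (0 : ℝ))} (hB : MeasurableSet B)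
    {f g : PAff → ℝ} (hf : Continuous f) (hfc : HasCompactSupport f) (hg : Continuous g)
    (hgc : HasCompactSupport g) :
    Integrable (fun x => symbolWeight B x (0, 0) *
      ∫ y, f y * coeffRe y * g (y⁻¹ * x) ∂PAff.haar) PAff.haar ∧
    (∑ r : PDual, ∫ x, pairingTrace (symbolWeight B) (kVec 1) (kVec 0) (fun y => (f y : ℂ))
      (fun y => (g y : ℂ)) x r ∂PAff.haar).re =
    ∫ x, symbolWeight B x (0, 0) * ∫ y, f y * coeffRe y * g (y⁻¹ * x) ∂PAff.haar ∂PAff.haar := by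
  have hf' : Continuous fun y => (f y : ℂ) := Complex.continuous_ofReal.comp hf
  have hg' : Continuous fun y => (g y : ℂ) := Complex.continuous_ofReal.comp hg
  have hfc' : HasCompactSupport fun y => (f y : ℂ) :=
    hfc.comp_left (g := Complex.ofReal) Complex.ofReal_zero
  have hgc' : HasCompactSupport fun y => (g y : ℂ) :=
    hgc.comp_left (g := Complex.ofReal) Complex.ofReal_zero
  have hint := integrable_pairingTrace (v := kVec 0) (w := kVec 1) (measurable_symbolWeight hB)
    abs_symbolWeight_le_one hf' hfc' hg' hgc' (0, 0)
  have hre : ∀ x, (pairingTrace (symbolWeight B) (kVec 1) (kVec 0) (fun y => (f y : ℂ))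
      (fun y => (g y : ℂ)) x (0, 0)).re =
      symbolWeight B x (0, 0) * ∫ y, f y * coeffRe y * g (y⁻¹ * x) ∂PAff.haar := by
    intro x
    have hi : Integrable (fun y => (f y : ℂ) * coeffK (0, 0) (kVec 1 (0, 0)) (kVec 0 (0, 0)) y *
        (g (y⁻¹ * x) : ℂ)) PAff.haar :=
      ((hf'.mul (continuous_coeffK _ _ _)).mul
        (hg'.comp (by fun_prop : Continuous fun y : PAff => y⁻¹ * x))).integrable_of_hasCompactSupport
        hfc'.mul_right.mul_right
    rw [pairingTrace, Complex.re_ofReal_mul]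
    congr 1
    refine (integral_re hi).symm.trans (integral_congr_ae (Filter.Eventually.of_forall fun y => ?_))
    change ((f y : ℂ) * coeffK (0, 0) (kVec 1 (0, 0)) (kVec 0 (0, 0)) y * (g (y⁻¹ * x) : ℂ)).re = _
    rw [Complex.re_mul_ofReal, Complex.re_ofReal_mul]
    rfl
  constructor
  · simp only [← hre]
    exact hint.re
  · rw [Finset.sum_eq_single (0, 0)]
    · refine (integral_re hint).symm.trans ?_
      exact integral_congr_ae (Filter.Eventually.of_forall hre)
    · intro r _ hr
      simp [pairingTrace, symbolWeight, hr]
    · simp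

/-- Over `B` and `|ϑ| ≤ N` the convolution is at least `κ / √2` times the angular weight. The symbol
supplies a second copy of that weight, and the product `(1 + |ϑ|)⁻¹` integrates to `angleMass N`. -/
lemma exists_pairing_lower_bound {B : Set ((ℝ × ℝ) × Set.Ioi (0 : ℝ))} (hB : IsCompact B)
    (hBp : 0 < PAff.transDilMeasure B) {V : Set PAff} (hVt : ∀ y ∈ V, |y.th| ≤ 1)
    {f : PAff → ℝ} (hf : Continuous f) (hfc : HasCompactSupport f) (hfV : ∀ y, y ∉ V → f y = 0)
    (hfn : ∀ y, 0 ≤ f y * coeffRe y) (hfp : 0 < ∫ y, f y * coeffRe y ∂PAff.haar)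
    {β : (ℝ × ℝ) × Set.Ioi (0 : ℝ) → ℝ} (hβ : Continuous β) (hβc : HasCompactSupport β)
    (hβn : ∀ q, 0 ≤ β q)
    (hβ1 : ∀ y ∈ V, ∀ x : PAff, x.transDil ∈ B → β (y⁻¹ * x).transDil = 1) :
    ∃ δ : ℝ, 0 < δ ∧ ∀ N : ℝ, 0 ≤ N → δ * angleMass N ≤
      (∑ r : PDual, ∫ x, pairingTrace (symbolWeight B) (kVec 1) (kVec 0) (fun y => (f y : ℂ))
        (fun y => (testFun β N y : ℂ)) x r ∂PAff.haar).re := by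
  set κ := ∫ y, f y * coeffRe y ∂PAff.haar with hκ
  refine ⟨(PAff.transDilMeasure B).toReal * (κ / Real.sqrt 2),
    mul_pos (ENNReal.toReal_pos hBp.ne' hB.measure_lt_top.ne) (by positivity), fun N hN => ?_⟩
  have hg := continuous_testFun hβ N
  obtain ⟨hint, heq⟩ := re_sum_integral_pairingTrace hB.measurableSet hf hfc hg
    (hasCompactSupport_testFun hβc N)
  have hgn : ∀ x, 0 ≤ testFun β N x := fun x =>
    mul_nonneg (hβn _) (mul_nonneg (angleWeight_pos _).le (angleCutoff_nonneg _ _))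
  have hIn : ∀ x, 0 ≤ ∫ y, f y * coeffRe y * testFun β N (y⁻¹ * x) ∂PAff.haar := fun x =>
    integral_nonneg fun y => mul_nonneg (hfn y) (hgn _)
  have hlow : ∀ x : PAff, x.transDil ∈ B → x.th ∈ Set.Icc (-N) N →
      κ * (angleWeight x.th / Real.sqrt 2) ≤
        ∫ y, f y * coeffRe y * testFun β N (y⁻¹ * x) ∂PAff.haar := by
    intro x hx ht
    have hfc2 : Continuous fun y => f y * coeffRe y := hf.mul continuous_coeffRe
    rw [hκ, ← integral_mul_const]
    refine integral_mono ?_ ?_ fun y => ?_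
    · exact (hfc2.mul continuous_const).integrable_of_hasCompactSupport hfc.mul_right.mul_right
    · exact (hfc2.mul (hg.comp (by fun_prop : Continuous fun y : PAff => y⁻¹ * x))
        ).integrable_of_hasCompactSupport hfc.mul_right.mul_right
    · by_cases hy : y ∈ V
      · refine mul_le_mul_of_nonneg_left ?_ (hfn y)
        have hth : (y⁻¹ * x).th = -y.th + x.th := rfl
        -- The shift by the angle of `y` costs at most 1, which is why the cutoff equals one up to
        -- `N + 1`.
        have hcut : |-y.th + x.th| ≤ N + 1 := by
          have h1 := abs_add_le (-y.th) x.th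
          rw [abs_neg] at h1
          linarith [hVt y hy, abs_le.2 ht]
        rw [testFun, hβ1 y hy x hx, hth, angleCutoff_eq_one hcut, one_mul, mul_one,
          div_le_iff₀ (by positivity), mul_comm]
        exact angleWeight_le_mul _ _ (hVt y hy)
      · simp [hfV y hy]
  have hJ : 0 ≤ angleMass N := (Real.log_nonneg (by linarith)).trans (log_le_angleMass hN)
  have hnn : 0 ≤ fun x => symbolWeight B x (0, 0) *
      ∫ y, f y * coeffRe y * testFun β N (y⁻¹ * x) ∂PAff.haar := fun x =>
    mul_nonneg (symbolWeight_nonneg x _) (hIn x)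
  rw [heq, ← ENNReal.ofReal_le_ofReal_iff (integral_nonneg hnn),
    ofReal_integral_eq_lintegral_ofReal hint (Filter.Eventually.of_forall hnn), mul_assoc,
    ENNReal.ofReal_mul ENNReal.toReal_nonneg, ENNReal.ofReal_toReal hB.measure_lt_top.ne,
    ENNReal.ofReal_mul (by positivity), ← lintegral_indicator_Icc_angle hN,
    ← lintegral_indicator_one hB.measurableSet, ← lintegral_const_mul' _ _ ENNReal.ofReal_ne_top,
    ← PAff.lintegral_haar_mul (measurable_one.indicator hB.measurableSet)
      ((continuous_one_add_abs_inv.measurable.ennreal_ofReal.indicator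
        measurableSet_Icc).const_mul _)]
  refine lintegral_mono fun x => ?_
  by_cases hx : x.transDil ∈ B
  · by_cases ht : x.th ∈ Set.Icc (-N) N
    · rw [Set.indicator_of_mem hx, Set.indicator_of_mem ht, Pi.one_apply, one_mul,
        ← ENNReal.ofReal_mul (by positivity), ← angleWeight_sq]
      refine ENNReal.ofReal_le_ofReal ?_
      have hs : symbolWeight B x (0, 0) = angleWeight x.th := by simp [symbolWeight, hx]
      rw [hs]
      refine le_trans (le_of_eq ?_)
        (mul_le_mul_of_nonneg_left (hlow x hx ht) (angleWeight_pos x.th).le)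
      ring
    · simp [ht]
  · simp [hx]

/-- As `g` is real, the bilinear integral is an inner product, and Cauchy-Schwarz applies. -/
lemma norm_integral_mul_le {T : L2G →L[ℂ] L2G} (φ : L2G) {g : PAff → ℝ}
    (hg : Continuous fun x => (g x : ℂ)) (hgc : HasCompactSupport fun x => (g x : ℂ)) :
    ‖∫ x, T φ x * (g x : ℂ) ∂PAff.haar‖ ≤ ‖T φ‖ * ‖ccToL2 (fun x => (g x : ℂ)) hg hgc‖ := by
  have h : ∫ x, T φ x * (g x : ℂ) ∂PAff.haar =
      ⟪ccToL2 (fun x => (g x : ℂ)) hg hgc, T φ⟫_ℂ := by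
    rw [L2.inner_def]
    refine integral_congr_ae ?_
    filter_upwards [(hg.memLp_of_hasCompactSupport (p := 2) (μ := PAff.haar) hgc).coeFn_toLp]
      with x hx
    rw [ccToL2, hx, RCLike.inner_apply, Complex.conj_ofReal]
  rw [h, mul_comm]
  exact norm_inner_le_norm _ _

lemma not_forall_sq_le {δ C : ℝ} (hδ : 0 < δ) (hC : 0 ≤ C) :
    ¬ ∀ N : ℝ, 0 ≤ N → (δ * angleMass N) ^ 2 ≤ C * angleMass (N + 2) := by
  intro h
  -- At `N = e^M - 1` the mass `J` is at least `log (1 + N) = M`. The entry 4 gives `J + 4 ≤ 2J`;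
  -- the other entry forces `δ² J > 2C`.
  set M := max 4 (2 * C / δ ^ 2 + 1) with hM
  have hM4 : 4 ≤ M := le_max_left _ _
  have hN : 0 ≤ Real.exp M - 1 := by linarith [Real.add_one_le_exp M]
  have h1 := h _ hN
  have h2 := log_le_angleMass hN
  have h3 := angleMass_add_two_le (Real.exp M - 1)
  rw [add_sub_cancel, Real.log_exp] at h2
  set J := angleMass (Real.exp M - 1)
  have hJ : 2 * C / δ ^ 2 + 1 ≤ J := (le_max_right _ _).trans h2
  have h4 : (δ * J) ^ 2 ≤ C * (2 * J) :=
    h1.trans (mul_le_mul_of_nonneg_left (by linarith) hC)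
  have hJ0 : 0 < J := by linarith
  have h5 : δ ^ 2 * J ≤ 2 * C := by
    refine le_of_mul_le_mul_right ?_ hJ0
    linarith
  have h6 : 2 * C < δ ^ 2 * J := by
    have : 2 * C / δ ^ 2 < J := by linarith
    rw [div_lt_iff₀ (by positivity)] at this
    linarith
  linarith

end

theorem theorem4p3 (p : ℝ) (hp : 2 < p) :
    ∃ σ : OpSymbol, MemLpSymbol p σ ∧ WeylDefined σ ∧
      ¬ ∃ T : L2G →L[ℂ] L2G, IsWeylTransform σ T := by
  obtain ⟨B, hB, hBn⟩ := exists_compact_mem_nhds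
    (((0, 0), ⟨1, Set.mem_Ioi.2 one_pos⟩) : (ℝ × ℝ) × Set.Ioi (0 : ℝ))
  have hBp : 0 < PAff.transDilMeasure B := Measure.measure_pos_of_mem_nhds _ hBn
  have huw : ∀ r, KPowGraph r 1 (kVec 0 r) (kVec 1 r) := fun r => kPowGraph_kVec 1 r
  have hpair := fun {f g : PAff → ℂ} => hasPairing_rankOneSymbol_iff (v := kVec 0) huw
    (measurable_symbolWeight hB.measurableSet) abs_symbolWeight_le_one (f := f) (g := g)
  refine ⟨rankOneSymbol (symbolWeight B) (kVec 0) (kVec 0), ?_, ?_, ?_⟩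
  · exact memLpSymbol_rankOneSymbol (by linarith)
      -- The image of `kVec 0` under `K^{1/p}` is `kVec (1 / p)`.
      (kPowGraph_kVec ⟨1 / p, by positivity⟩)
      (measurable_symbolWeight hB.measurableSet) (lintegral_symbolWeight_lt_top hB hp)
  · exact fun f g hf hfc hg hgc => ⟨_, (hpair hf hfc hg hgc _).2 rfl⟩
  · rintro ⟨T, hT⟩
    obtain ⟨V, f, hV, hVt, hf, hfc, hfV, hfn, hfp⟩ := exists_bump
    obtain ⟨β, hβ, hβc, hβn, hβ1⟩ := exists_test_profile hB hV
    obtain ⟨δ, hδ, hlow⟩ :=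
      exists_pairing_lower_bound hB hBp hVt hf hfc hfV hfn hfp hβ hβc hβn hβ1
    obtain ⟨C, hC, hup⟩ := norm_ccToL2_testFun_sq_le hβ hβc
    have hf' : Continuous fun y => (f y : ℂ) := Complex.continuous_ofReal.comp hf
    have hfc' : HasCompactSupport fun y => (f y : ℂ) :=
      hfc.comp_left (g := Complex.ofReal) Complex.ofReal_zero
    set φ := ccToL2 _ hf' hfc' with hφ
    -- Only `g` varies with `N`; since `f` is fixed, `‖T φ‖` is a constant.
    refine not_forall_sq_le hδ (mul_nonneg (sq_nonneg ‖T φ‖) hC) fun N hN => ?_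
    have hg : Continuous fun y => (testFun β N y : ℂ) :=
      Complex.continuous_ofReal.comp (continuous_testFun hβ N)
    have hgc : HasCompactSupport fun y => (testFun β N y : ℂ) :=
      (hasCompactSupport_testFun hβc N).comp_left (g := Complex.ofReal) Complex.ofReal_zero
    have h1 := (hpair hf' hfc' hg hgc _).1 (hT _ _ hf' hfc' hg hgc)
    have h2 := hlow N hN
    rw [← h1] at h2
    have h3 := h2.trans ((Complex.re_le_norm _).trans (norm_integral_mul_le (T := T) φ hg hgc))
    have hJ : 0 ≤ angleMass N := (Real.log_nonneg (by linarith)).trans (log_le_angleMass hN)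
    calc (δ * angleMass N) ^ 2 ≤ (‖T φ‖ * ‖ccToL2 _ hg hgc‖) ^ 2 :=
          pow_le_pow_left₀ (by positivity) h3 2
      _ = ‖T φ‖ ^ 2 * ‖ccToL2 _ hg hgc‖ ^ 2 := mul_pow _ _ _
      _ ≤ ‖T φ‖ ^ 2 * (C * angleMass (N + 2)) :=
          mul_le_mul_of_nonneg_left (hup N hN hg hgc) (sq_nonneg _)
      _ = ‖T φ‖ ^ 2 * C * angleMass (N + 2) := by ring
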